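/- Let $X,Y$ be complex Banach spaces, let $\Omega\subset\mathbb C$ be open and connected, and let $Q:\Omega\times\mathbb C\to\mathcal L(X,Y)$ be a holomorphic family of bounded operators such that every $Q(\alpha,k)$ is a Fredholm operator of index $0$. Suppose that there are a lattice $\Gamma^*\subset\mathbb C$ (a discrete subgroup spanning $\mathbb C$ over $\mathbb R$) and bounded invertible operators $W_X(\gamma):X\to X$, $W_Y(\gamma):Y\to Y$, $\gamma\in\Gamma^*$, such that $$Q(\alpha,k+\gamma)=W_Y(\gamma)^{-1}Q(\alpha,k)W_X(\gamma),\qquad \alpha\in\Omega,\ k\in\mathbb C,\ \gamma\in\Gamma^*.$$ For $\alpha\in\Omega$ and $k\in\mathbb C$ define the multiplicity $m(\alpha,k)$ as follows. If $\ker Q(\alpha,k_0)=\{0\}$ for some $k_0\in\mathbb C$, then $\zeta\mapsto Q(\alpha,\zeta)^{-1}$ is a meromorphic family of operators on $\mathbb C$, and $$m(\alpha,k):=\frac1{2\pi i}\operatorname{tr}\oint_{\partial D}Q(\alpha,\zeta)^{-1}\,\partial_\zeta Q(\alpha,\zeta)\,d\zeta ,$$ where $D$ is a disc centred at $k$ such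 that $k$ is the only possible pole of $\zeta\mapsto Q(\alpha,\zeta)^{-1}$ in $\overline D$, and $\partial D$ is positively oriented (the integral is an operator of finite rank and does not depend on the choice of $D$). Otherwise $m(\alpha,k):=\infty$ for all $k\in\mathbb C$. Suppose that for some $\alpha_0\in\Omega$ we have $$m(\alpha,k)\ \ge\ m(\alpha_0,k)\ \neq\ \infty\qquad\text{for all }\alpha\in\Omega,\ k\in\mathbb C.$$ Then there is a discrete set $\mathcal A\subset\Omega$ (that is, $\mathcal A$ has no accumulation point in $\Omega$) such that for all $k\in\mathbb C$ $$m(\alpha,k)=\begin{cases}\infty,&\alpha\in\mathcal A,\\ m(\alpha_0,k),&\alpha\in\Omega\setminus\mathcal A.\end{cases}$$ -/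

import Mathlib

namespace FlatBands

variable {X Y : Type*} [NormedAddCommGroup X] [NormedSpace ℂ X]
  [NormedAddCommGroup Y] [NormedSpace ℂ Y]

/-- A Fredholm operator of index `0`: Fredholm, with `dim ker T = dim coker T`. -/
def IsFredholmIndexZero (T : X →L[ℂ] Y) : Prop :=
  T.IsFredholm ∧ Module.finrank ℂ T.ker = Module.finrank ℂ (Y ⧸ T.range)

/-- The trace of a bounded operator of finite rank: the trace of the endomorphism that it induces
on its (finite-dimensional) range. -/
noncomputable def finiteRankTrace (A : X →L[ℂ] X) : ℂ :=
  LinearMap.trace ℂ A.range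
    ((A : X →ₗ[ℂ] X).restrict (p := A.range) (q := A.range) fun x _ => ⟨x, rfl⟩)

/-- `r` is the radius of a disc about `k` such that `k` is the only possible pole of
`ζ ↦ (F ζ)⁻¹` in the closed disc. -/
def IsIsolatingRadius (F : ℂ → X →L[ℂ] Y) (k : ℂ) (r : ℝ) : Prop :=
  0 < r ∧ ∀ ζ ∈ Metric.closedBall k r, ζ ≠ k → (F ζ).IsInvertible

/-- `(2πi)⁻¹ tr ∮ F(ζ)⁻¹ F'(ζ) dζ` over the positively oriented circle of centre `k` and
radius `r`. -/
noncomputable def logResidueTrace (F : ℂ → X →L[ℂ] Y) (k : ℂ) (r : ℝ) : ℂ :=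
  (2 * Real.pi * Complex.I)⁻¹ *
    finiteRankTrace (∮ ζ in C(k, r), (F ζ).inverse ∘L deriv F ζ)

/-- The logarithmic residue does not depend on the choice of the isolating radius. -/
theorem logResidueTrace_eq [CompleteSpace X] [CompleteSpace Y] {F : ℂ → X →L[ℂ] Y}
    (hF : Differentiable ℂ F) {k : ℂ} {r R : ℝ}
    (hr : IsIsolatingRadius F k r) (hR : IsIsolatingRadius F k R) :
    logResidueTrace F k r = logResidueTrace F k R := by
  wlog h : r ≤ R generalizing r R
  · exact (this hR hr (le_of_not_ge h)).symm
  have hd : ∀ z ∈ Metric.closedBall k R \ Metric.ball k r,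
      DifferentiableAt ℂ (fun ζ => (F ζ).inverse ∘L deriv F ζ) z := by
    intro z hz
    have hne : z ≠ k := by
      rintro rfl
      exact hz.2 (Metric.mem_ball_self hr.1)
    have hinv := hR.2 z hz.1 hne
    have h1 : DifferentiableAt ℂ (fun ζ => (F ζ).inverse) z :=
      DifferentiableAt.comp z
        ((hinv.contDiffAt_map_inverse (n := 1)).differentiableAt one_ne_zero) (hF z)
    have h2 : DifferentiableAt ℂ (deriv F) z :=
      ((hF.analyticAt z).deriv).differentiableAt
    exact h1.clm_comp h2
  unfold logResidueTrace
  rw [Complex.circleIntegral_eq_of_differentiable_on_annulus_off_countable hr.1 h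
    Set.countable_empty (fun z hz => (hd z hz).continuousAt.continuousWithinAt)
    (fun z hz => hd z ⟨Metric.ball_subset_closedBall hz.1.1,
      fun hz' => hz.1.2 (Metric.ball_subset_closedBall hz')⟩)]

open Classical in
/-- The multiplicity `m(α, k)` of the family `Q`. If `Q(α, k₀)` is injective for some `k₀`, it is
the trace of the logarithmic residue of `Q(α, ·)` at `k`, computed on any isolating circle;
otherwise it is `∞` for all `k`. -/
noncomputable def mult (Q : ℂ → ℂ → X →L[ℂ] Y) (α k : ℂ) : WithTop ℂ :=
  if ∃ k₀ : ℂ, (Q α k₀).ker = ⊥ then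
    ((logResidueTrace (Q α) k (Classical.epsilon (IsIsolatingRadius (Q α) k)) : ℂ) : WithTop ℂ)
  else ⊤

end FlatBands

open scoped ComplexOrder

/-! Near any point `(α₁, k₁)`, an index-zero Fredholm family becomes invertible after adding one
fixed operator `q p` that factors through `ℂⁿ`. This yields a scalar holomorphic function `d(α, k) =
det(1 - p (Q + q p)⁻¹ q)` that vanishes exactly where `Q` is not invertible and has the same
logarithmic residues in `k` (`logResidueTrace_eq_circleIntegral_logDeriv`). If the slice at `α` is
not everywhere singular, the multiplicity is thus the order of a zero of `d(α, ·)`. By Hurwitz's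
theorem it splits, for nearby parameters, into multiplicities with the same sum
(`eventually_mult_eq_sum`).

The exceptional set `A` consists of the parameters whose whole slice is singular. The identity
theorem in `α` and the connectedness of `Ω` make it discrete, since it misses `α₀`
(`eventually_nhdsNE_exists_isInvertible`).

Off `A`, the condition `m(α, ·) = m(α₀, ·)` is open and closed. Open: the multiplicities at such an
`α` are minimal, so a zero can neither move nor split, because the multiplicity at its old position
would drop (`eventually_mult_eq_of_le`); lattice periodicity and compactness make this uniform in
`k`. Closed: parameters with the multiplicities of `α₀` have no zero in a small disc except possibly
its centre, so the sum rule passes the value at the centre to the limit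
(`eventually_ne_of_mult_ne`). Finally, a set without accumulation points does not disconnect `Ω`
(`forall_of_forall_eventually`). -/

namespace FlatBands

open ContinuousLinearMap

variable {X Y : Type*} [NormedAddCommGroup X] [NormedSpace ℂ X]
  [NormedAddCommGroup Y] [NormedSpace ℂ Y]

/-! ### Index-zero Fredholm operators and their finite-rank corrections. -/

section Fredholm

theorem isInvertible_of_ker_eq_bot_of_range_eq_top [CompleteSpace X] [CompleteSpace Y]
    {T : X →L[ℂ] Y} (hk : T.ker = ⊥) (hr : T.range = ⊤) : T.IsInvertible :=
  ⟨ContinuousLinearEquiv.ofBijective T hk hr, by ext; rfl⟩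

theorem ker_eq_bot_of_isInvertible {T : X →L[ℂ] Y} (hT : T.IsInvertible) : T.ker = ⊥ := by
  obtain ⟨e, rfl⟩ := hT
  exact LinearMap.ker_eq_bot.2 e.injective

theorem IsFredholmIndexZero.isInvertible_iff [CompleteSpace X] [CompleteSpace Y]
    {T : X →L[ℂ] Y} (hT : IsFredholmIndexZero T) : T.IsInvertible ↔ T.ker = ⊥ := by
  refine ⟨ker_eq_bot_of_isInvertible, fun hk => ?_⟩
  refine isInvertible_of_ker_eq_bot_of_range_eq_top hk ?_
  have hfin : Module.Finite ℂ (Y ⧸ T.range) := hT.1.finite_coker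
  have h0 : Module.finrank ℂ (Y ⧸ T.range) = 0 := by
    rw [← hT.2, hk, finrank_bot]
  exact Submodule.Quotient.subsingleton_iff.1 (Module.finrank_zero_iff.1 h0)

/-- A Fredholm operator of index zero becomes invertible after adding a suitable operator that
factors through a finite-dimensional space. -/
theorem IsFredholmIndexZero.exists_isInvertible_add_comp [CompleteSpace X] [CompleteSpace Y]
    {T : X →L[ℂ] Y} (hT : IsFredholmIndexZero T) :
    ∃ (n : ℕ) (p : X →L[ℂ] (Fin n → ℂ)) (q : (Fin n → ℂ) →L[ℂ] Y), (T + q ∘L p).IsInvertible := by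
  obtain ⟨hF, hdim⟩ := hT
  have := hF.finite_ker
  have : Module.Finite ℂ (Y ⧸ T.range) := hF.finite_coker
  obtain ⟨P, hP⟩ := hF.closedComplemented_ker
  obtain ⟨C, hC⟩ := T.range.exists_isCompl
  let eC : (Y ⧸ T.range) ≃ₗ[ℂ] C := Submodule.quotientEquivOfIsCompl _ C hC
  have : FiniteDimensional ℂ C := eC.finiteDimensional
  have hdC : Module.finrank ℂ T.ker = Module.finrank ℂ C := hdim.trans eC.finrank_eq
  let n := Module.finrank ℂ T.ker
  let e₁ : T.ker ≃L[ℂ] (Fin n → ℂ) := ContinuousLinearEquiv.ofFinrankEq (by simp [n])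
  let e₂ : (Fin n → ℂ) ≃L[ℂ] C := ContinuousLinearEquiv.ofFinrankEq (by simp [n, hdC])
  -- `p` reads off the kernel component and `q` carries it isomorphically onto a complement of the
  -- range; index zero is what makes the two dimensions agree.
  refine ⟨n, (e₁ : T.ker →L[ℂ] (Fin n → ℂ)) ∘L P, C.subtypeL ∘L (e₂ : (Fin n → ℂ) →L[ℂ] C), ?_⟩
  apply isInvertible_of_ker_eq_bot_of_range_eq_top
  · rw [LinearMap.ker_eq_bot']
    intro x hx
    have hx' : T x + (e₂ (e₁ (P x)) : Y) = 0 := hx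
    have hmem : T x ∈ T.range ⊓ C := by
      refine ⟨⟨x, rfl⟩, ?_⟩
      rw [eq_neg_of_add_eq_zero_left hx']
      exact C.neg_mem (e₂ _).2
    have hTx : T x = 0 := by
      rw [hC.inf_eq_bot] at hmem
      exact (Submodule.mem_bot ℂ).1 hmem
    rw [hTx, zero_add] at hx'
    have hPx : P x = 0 := by
      have : e₂ (e₁ (P x)) = 0 := Subtype.ext hx'
      simpa using this
    have := hP ⟨x, hTx⟩
    rw [hPx] at this
    exact (congrArg Subtype.val this).symm
  · rw [LinearMap.range_eq_top]
    intro y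
    have hy : y ∈ T.range ⊔ C := by rw [hC.sup_eq_top]; trivial
    obtain ⟨_, ⟨x, rfl⟩, c, hc, rfl⟩ := Submodule.mem_sup.1 hy
    let w : T.ker := e₁.symm (e₂.symm ⟨c, hc⟩)
    -- The kernel component of `x` is replaced by the one that `q p` sends to `c`; the value of `T`
    -- does not change.
    refine ⟨x - P x + w, ?_⟩
    have h1 : P (x - P x + w) = w := by
      rw [map_add, map_sub, hP, hP]; simp
    have h2 : T (x - P x + w) = T x := by
      have ha : T (P x : X) = 0 := (P x).2
      have hb : T (w : X) = 0 := w.2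
      rw [map_add, map_sub, ha, hb]; simp
    change T (x - P x + w) + (e₂ (e₁ (P (x - P x + w))) : Y) = T x + c
    rw [h1, h2]
    simp [w]

end Fredholm

/-! ### Traces of finite-rank operators. -/

section Trace

/-- For an operator that factors through a finite-dimensional space, the finite-rank trace is the
trace of the composition in the opposite order. -/
theorem finiteRankTrace_comp {V : Type*} [NormedAddCommGroup V] [NormedSpace ℂ V]
    [FiniteDimensional ℂ V] (a : V →L[ℂ] X) (c : X →L[ℂ] V) :
    finiteRankTrace (a ∘L c) = LinearMap.trace ℂ V (c ∘L a : V →L[ℂ] V) := by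
  set R := (a ∘L c).range
  have hfin : FiniteDimensional ℂ R := by
    have : R ≤ a.range := LinearMap.range_comp_le_range _ _
    exact Submodule.finiteDimensional_of_le this
  let f : V →ₗ[ℂ] V := (c ∘L a : V →L[ℂ] V)
  -- Between the two finite-dimensional ranges, the restrictions of `a c` and `c a` become `a' c'`
  -- and `c' a'`, so cyclicity of the ordinary trace applies.
  let c' : R →ₗ[ℂ] f.range :=
    ((c : X →ₗ[ℂ] V) ∘ₗ R.subtype).codRestrict f.range (by
      rintro ⟨_, x, rfl⟩
      exact ⟨c x, rfl⟩)
  let a' : f.range →ₗ[ℂ] R :=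
    ((a : V →ₗ[ℂ] X) ∘ₗ f.range.subtype).codRestrict R (by
      rintro ⟨_, x, rfl⟩
      exact ⟨a x, rfl⟩)
  have h1 := LinearMap.trace_comp_comm' (R := ℂ) c' a'
  have h2 := LinearMap.trace_restrict_eq_of_forall_mem f.range f (fun x => ⟨x, rfl⟩)
  change _ = LinearMap.trace ℂ V f
  rw [← h2]
  exact h1

theorem finiteRankTrace_conj (e : X ≃L[ℂ] X) (A : X →L[ℂ] X) :
    finiteRankTrace ((e.symm : X →L[ℂ] X) ∘L A ∘L (e : X →L[ℂ] X)) = finiteRankTrace A := by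
  set B := (e.symm : X →L[ℂ] X) ∘L A ∘L (e : X →L[ℂ] X)
  let E : A.range ≃ₗ[ℂ] B.range := LinearEquiv.ofSubmodules e.symm.toLinearEquiv _ _ (by
    ext x
    constructor
    · rintro ⟨_, ⟨y, rfl⟩, rfl⟩
      exact ⟨e.symm y, by simp [B]⟩
    · rintro ⟨y, rfl⟩
      exact ⟨A (e y), ⟨e y, rfl⟩, by simp [B]⟩)
  unfold finiteRankTrace
  rw [← LinearMap.trace_conj' _ E]
  congr 1

end Trace

/-! ### Determinant, adjugate and Jacobi's formula on `ℂⁿ`. -/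

section Det

variable {n : ℕ}

theorem differentiable_matrix_det_of_entries {E : Type*} [NormedAddCommGroup E] [NormedSpace ℂ E]
    {f : E → Matrix (Fin n) (Fin n) ℂ} (hf : ∀ i j, Differentiable ℂ fun x => f x i j) :
    Differentiable ℂ fun x => (f x).det := by
  simp only [Matrix.det_apply']
  fun_prop

theorem differentiable_toMatrix'_apply (i j : Fin n) :
    Differentiable ℂ fun M : (Fin n → ℂ) →L[ℂ] (Fin n → ℂ) =>
      LinearMap.toMatrix' (M : (Fin n → ℂ) →ₗ[ℂ] (Fin n → ℂ)) i j := by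
  simp only [LinearMap.toMatrix'_apply]
  intro M
  have : DifferentiableAt ℂ (fun M : (Fin n → ℂ) →L[ℂ] (Fin n → ℂ) =>
      M (Pi.single j 1)) M := by fun_prop
  simpa using (differentiableAt_pi.1 this) i

theorem differentiable_det :
    Differentiable ℂ fun M : (Fin n → ℂ) →L[ℂ] (Fin n → ℂ) =>
      LinearMap.det (M : (Fin n → ℂ) →ₗ[ℂ] (Fin n → ℂ)) := by
  simp only [← LinearMap.det_toMatrix']
  exact differentiable_matrix_det_of_entries differentiable_toMatrix'_apply

/-- The adjugate of an endomorphism of `ℂⁿ`. -/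
noncomputable def adjugateL (M : (Fin n → ℂ) →L[ℂ] (Fin n → ℂ)) : (Fin n → ℂ) →L[ℂ] (Fin n → ℂ) :=
  LinearMap.toContinuousLinearMap (Matrix.toLin'
    (LinearMap.toMatrix' (M : (Fin n → ℂ) →ₗ[ℂ] (Fin n → ℂ))).adjugate)

/-- The entries are polynomials in those of `M`. Unlike the inverse, the adjugate therefore stays
holomorphic where the determinant vanishes, which leaves a scalar denominator as the only source of
poles. -/
theorem differentiable_adjugateL :
    Differentiable ℂ (adjugateL : ((Fin n → ℂ) →L[ℂ] (Fin n → ℂ)) → _) := by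
  let B : Matrix (Fin n) (Fin n) ℂ →ₗ[ℂ] ((Fin n → ℂ) →L[ℂ] (Fin n → ℂ)) :=
    (LinearMap.toContinuousLinearMap (E := Fin n → ℂ) (F' := Fin n → ℂ)).toLinearMap ∘ₗ
      Matrix.toLin'.toLinearMap
  have h : ∀ M : (Fin n → ℂ) →L[ℂ] (Fin n → ℂ), adjugateL M =
      ∑ i, ∑ j, (LinearMap.toMatrix' (M : (Fin n → ℂ) →ₗ[ℂ] (Fin n → ℂ))).adjugate i j •
        B (Matrix.single i j 1) := by
    intro M
    simp only [← map_smul, ← map_sum, Matrix.smul_single, smul_eq_mul, mul_one]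
    rw [← Matrix.matrix_eq_sum_single]
    rfl
  rw [show (adjugateL : ((Fin n → ℂ) →L[ℂ] (Fin n → ℂ)) → _) = _ from funext h]
  refine Differentiable.fun_sum fun i _ => Differentiable.fun_sum fun j _ =>
    Differentiable.smul_const ?_ _
  simp only [Matrix.adjugate_apply]
  refine differentiable_matrix_det_of_entries fun a b => ?_
  by_cases hab : a = j
  · subst hab; simp
  · simpa [Matrix.updateRow_ne hab] using differentiable_toMatrix'_apply a b

theorem adjugateL_comp (M : (Fin n → ℂ) →L[ℂ] (Fin n → ℂ)) :
    adjugateL M ∘L M = LinearMap.det (M : (Fin n → ℂ) →ₗ[ℂ] (Fin n → ℂ)) •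
      ContinuousLinearMap.id ℂ (Fin n → ℂ) := by
  apply ContinuousLinearMap.coe_injective
  apply LinearMap.toMatrix'.injective
  have := Matrix.adjugate_mul (LinearMap.toMatrix' (M : (Fin n → ℂ) →ₗ[ℂ] (Fin n → ℂ)))
  rw [LinearMap.det_toMatrix'] at this
  simpa [adjugateL, LinearMap.toMatrix'_comp] using this

theorem comp_adjugateL (M : (Fin n → ℂ) →L[ℂ] (Fin n → ℂ)) :
    M ∘L adjugateL M = LinearMap.det (M : (Fin n → ℂ) →ₗ[ℂ] (Fin n → ℂ)) •
      ContinuousLinearMap.id ℂ (Fin n → ℂ) := by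
  apply ContinuousLinearMap.coe_injective
  apply LinearMap.toMatrix'.injective
  have := Matrix.mul_adjugate (LinearMap.toMatrix' (M : (Fin n → ℂ) →ₗ[ℂ] (Fin n → ℂ)))
  rw [LinearMap.det_toMatrix'] at this
  simpa [adjugateL, LinearMap.toMatrix'_comp] using this

/-- The determinant is a polynomial in `t` with constant term `1` and linear coefficient the trace.
-/
theorem hasDerivAt_det_one_add_smul (N : (Fin n → ℂ) →ₗ[ℂ] (Fin n → ℂ)) :
    HasDerivAt (fun t : ℂ => LinearMap.det (1 + t • N)) (LinearMap.trace ℂ _ N) 0 := by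
  have h : ∀ t : ℂ, LinearMap.det (1 + t • N) =
      1 + (LinearMap.toMatrix' N).trace * t + Polynomial.eval t
        (1 + (Polynomial.X : Polynomial ℂ) • (LinearMap.toMatrix' N).map Polynomial.C).det.divX.divX * t ^ 2 := by
    intro t
    rw [← Matrix.det_one_add_smul, ← LinearMap.det_toMatrix']
    simp
  simp only [h]
  have htr : LinearMap.trace ℂ _ N = (LinearMap.toMatrix' N).trace := by
    rw [← Matrix.trace_toLin'_eq, Matrix.toLin'_toMatrix']
  rw [htr]
  set p := (1 + (Polynomial.X : Polynomial ℂ) • (LinearMap.toMatrix' N).map Polynomial.C).det.divX.divX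
  have h1 := ((hasDerivAt_id (0 : ℂ)).const_mul (LinearMap.toMatrix' N).trace).const_add 1
  have h2 := (p.hasDerivAt 0).mul ((hasDerivAt_id (0 : ℂ)).pow 2)
  refine (h1.add h2).congr_deriv ?_
  simp

/-- Jacobi's formula. -/
theorem deriv_det_comp {M : ℂ → (Fin n → ℂ) →L[ℂ] (Fin n → ℂ)} {z : ℂ}
    (hM : DifferentiableAt ℂ M z)
    (hz : LinearMap.det (M z : (Fin n → ℂ) →ₗ[ℂ] (Fin n → ℂ)) ≠ 0) :
    deriv (fun ζ => LinearMap.det (M ζ : (Fin n → ℂ) →ₗ[ℂ] (Fin n → ℂ))) z =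
      LinearMap.trace ℂ (Fin n → ℂ) (adjugateL (M z) ∘L deriv M z : (Fin n → ℂ) →L[ℂ] (Fin n → ℂ)) := by
  set D := fun M : (Fin n → ℂ) →L[ℂ] (Fin n → ℂ) =>
    LinearMap.det (M : (Fin n → ℂ) →ₗ[ℂ] (Fin n → ℂ)) with hD
  have h1 : HasDerivAt (fun ζ => D (M ζ)) (fderiv ℂ D (M z) (deriv M z)) z :=
    (differentiable_det (M z)).hasFDerivAt.comp_hasDerivAt z hM.hasDerivAt
  -- The directional derivative can be read off on a straight line, and there `M z + t M'(z) = M z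
  -- (1 + t N)` with `N = (M z)⁻¹ M'(z)`, the inverse being written as `δ⁻¹` times the adjugate.
  have h2 : HasDerivAt (fun t : ℂ => D (M z + t • deriv M z)) (fderiv ℂ D (M z) (deriv M z)) 0 := by
    have h3 : HasDerivAt (fun t : ℂ => M z + t • deriv M z) (deriv M z) 0 := by
      simpa using ((hasDerivAt_id (0 : ℂ)).smul_const (deriv M z)).const_add (M z)
    have h4 : HasFDerivAt D (fderiv ℂ D (M z)) (M z + (0 : ℂ) • deriv M z) := by
      have h0 : M z + (0 : ℂ) • deriv M z = M z := by ext; simp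
      rw [h0]
      exact (differentiable_det (M z)).hasFDerivAt
    exact h4.comp_hasDerivAt 0 h3
  set δ := D (M z) with hδ
  set N : (Fin n → ℂ) →L[ℂ] (Fin n → ℂ) := δ⁻¹ • (adjugateL (M z) ∘L deriv M z) with hN
  have hMN : M z ∘L N = deriv M z := by
    rw [hN, ContinuousLinearMap.comp_smul, ← ContinuousLinearMap.comp_assoc, comp_adjugateL]
    change δ⁻¹ • ((δ • ContinuousLinearMap.id ℂ _) ∘L deriv M z) = _
    rw [ContinuousLinearMap.smul_comp, ContinuousLinearMap.id_comp, smul_smul,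
      inv_mul_cancel₀ hz, one_smul]
  have h5 : (fun t : ℂ => D (M z + t • deriv M z)) =
      fun t => δ * LinearMap.det (1 + t • (N : (Fin n → ℂ) →ₗ[ℂ] (Fin n → ℂ))) := by
    funext t
    rw [hδ]
    simp only [hD]
    rw [← map_mul]
    congr 1
    conv_lhs => rw [← hMN]
    ext x i
    simp
  rw [h5] at h2
  have h6 := (hasDerivAt_det_one_add_smul
    (N : (Fin n → ℂ) →ₗ[ℂ] (Fin n → ℂ))).const_mul δ
  rw [h1.deriv, h2.unique h6, hN]
  simp only [ContinuousLinearMap.toLinearMap_smul, map_smul, smul_eq_mul]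
  rw [mul_inv_cancel_left₀ hz]

end Det

end FlatBands

namespace FlatBands

open Metric Filter Topology

/-! ### Zeros of scalar holomorphic functions: factorization, argument principle, Hurwitz. -/

section Scalar

variable {U : Set ℂ} {f : ℂ → ℂ}

theorem analyticOrderAt_sub_self (u : ℂ) : analyticOrderAt (fun z : ℂ => z - u) u = 1 := by
  have h : AnalyticAt ℂ (fun z : ℂ => z - u) u := by fun_prop
  exact_mod_cast (h.analyticOrderAt_eq_natCast (n := 1)).2
    ⟨fun _ => 1, analyticAt_const, one_ne_zero, by simp⟩

/-- Dividing by `z - u` through `dslope` keeps the quotient holomorphic on all of `U`, so the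
cofactor is not merely a germ at `u`. -/
theorem exists_eq_sub_pow_mul (hU : IsOpen U) {u : ℂ} (hu : u ∈ U) (hf : DifferentiableOn ℂ f U)
    {n : ℕ} (hn : analyticOrderAt f u = n) :
    ∃ h : ℂ → ℂ, DifferentiableOn ℂ h U ∧ h u ≠ 0 ∧ ∀ z ∈ U, f z = (z - u) ^ n * h z := by
  induction n generalizing f with
  | zero =>
    refine ⟨f, hf, ?_, by simp⟩
    exact ((hf.analyticAt (hU.mem_nhds hu)).analyticOrderAt_eq_zero).1 (by simpa using hn)
  | succ n ih =>
    have hfa := hf.analyticAt (hU.mem_nhds hu)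
    have hfu : f u = 0 := by
      by_contra h
      have := (hfa.analyticOrderAt_eq_zero).2 h
      rw [hn] at this
      exact absurd this (by simp)
    have hd : DifferentiableOn ℂ (dslope f u) U :=
      (Complex.differentiableOn_dslope (hU.mem_nhds hu)).2 hf
    have hfac : ∀ z, f z = (z - u) * dslope f u z := fun z => by
      have := sub_smul_dslope f u z
      rw [hfu, sub_zero, smul_eq_mul] at this
      exact this.symm
    have hda := hd.analyticAt (hU.mem_nhds hu)
    have hord : analyticOrderAt (dslope f u) u = n := by
      have h1 : f = (fun z => z - u) * dslope f u := funext hfac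
      have h2 := analyticOrderAt_mul (f := fun z : ℂ => z - u) (by fun_prop) hda
      rw [← h1, hn, analyticOrderAt_sub_self, add_comm] at h2
      push_cast at h2
      exact (ENat.add_right_injective_of_ne_top ENat.one_ne_top h2).symm
    obtain ⟨h, hh, hhu, hfh⟩ := ih hd hord
    refine ⟨h, hh, hhu, fun z hz => ?_⟩
    rw [hfac, hfh z hz]; ring

theorem exists_eq_prod_sub_pow_mul (hU : IsOpen U) (hf : DifferentiableOn ℂ f U) (Z : Finset ℂ)
    (hZ : ∀ u ∈ Z, u ∈ U ∧ analyticOrderAt f u ≠ ⊤) :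
    ∃ h : ℂ → ℂ, DifferentiableOn ℂ h U ∧ (∀ u ∈ Z, h u ≠ 0) ∧
      ∀ z ∈ U, f z = (∏ u ∈ Z, (z - u) ^ analyticOrderNatAt f u) * h z := by
  induction Z using Finset.induction_on with
  | empty => exact ⟨f, hf, by simp, by simp⟩
  | insert a Z ha ih =>
    obtain ⟨h, hh, hhZ, hfh⟩ := ih fun u hu => hZ u (Finset.mem_insert_of_mem hu)
    obtain ⟨haU, hatop⟩ := hZ a (Finset.mem_insert_self _ _)
    set P : ℂ → ℂ := fun z => ∏ u ∈ Z, (z - u) ^ analyticOrderNatAt f u with hP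
    have hPa : AnalyticAt ℂ P a := by
      have : Differentiable ℂ P := by fun_prop
      exact this.analyticAt a
    have hPa0 : analyticOrderAt P a = 0 := by
      refine hPa.analyticOrderAt_eq_zero.2 ?_
      refine Finset.prod_ne_zero_iff.2 fun u hu => pow_ne_zero _ (sub_ne_zero.2 ?_)
      rintro rfl
      exact ha hu
    have hord : analyticOrderAt h a = analyticOrderNatAt f a := by
      have h1 : f =ᶠ[𝓝 a] P * h := by
        filter_upwards [hU.mem_nhds haU] with z hz using hfh z hz
      rw [Nat.cast_analyticOrderNatAt hatop, analyticOrderAt_congr h1,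
        analyticOrderAt_mul hPa (hh.analyticAt (hU.mem_nhds haU)), hPa0, zero_add]
    obtain ⟨g, hg, hga, hhg⟩ := exists_eq_sub_pow_mul hU haU hh hord
    refine ⟨g, hg, ?_, ?_⟩
    · intro u hu
      rcases Finset.mem_insert.1 hu with rfl | hu
      · exact hga
      · intro h0
        refine hhZ u hu ?_
        rw [hhg u (hZ u (Finset.mem_insert_of_mem hu)).1, h0, mul_zero]
    · intro z hz
      rw [hfh z hz, hhg z hz, Finset.prod_insert ha]; ring

theorem circleIntegral_sub_inv_of_notMem_closedBall {c w : ℂ} {R : ℝ} (hR : 0 ≤ R)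
    (hw : w ∉ closedBall c R) : (∮ z in C(c, R), (z - w)⁻¹) = 0 := by
  have hd : ∀ z ∈ closedBall c R, DifferentiableAt ℂ (fun z => (z - w)⁻¹) z := by
    intro z hz
    have : z - w ≠ 0 := sub_ne_zero.2 (by rintro rfl; exact hw hz)
    fun_prop (disch := assumption)
  exact Complex.circleIntegral_eq_zero_of_differentiable_on_off_countable hR Set.countable_empty
    (fun z hz => (hd z hz).continuousAt.continuousWithinAt)
    (fun z hz => hd z (ball_subset_closedBall hz.1))

theorem circleIntegral_eq_zero_of_differentiableOn {E : Type*} [NormedAddCommGroup E]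
    [NormedSpace ℂ E] {g : ℂ → E} (hU : IsOpen U) {c : ℂ} {R : ℝ} (hR : 0 ≤ R)
    (hsub : closedBall c R ⊆ U) (hg : DifferentiableOn ℂ g U) : (∮ z in C(c, R), g z) = 0 :=
  Complex.circleIntegral_eq_zero_of_differentiable_on_off_countable hR Set.countable_empty
    (hg.continuousOn.mono hsub)
    (fun z hz => (hg z (hsub (ball_subset_closedBall hz.1))).differentiableAt
      (hU.mem_nhds (hsub (ball_subset_closedBall hz.1))))

theorem circleIntegral_logDeriv_eq_zero (hU : IsOpen U) (hf : DifferentiableOn ℂ f U) {c : ℂ}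
    {R : ℝ} (hR : 0 ≤ R) (hsub : closedBall c R ⊆ U) (h0 : ∀ z ∈ closedBall c R, f z ≠ 0) :
    (∮ z in C(c, R), logDeriv f z) = 0 := by
  have hd : ∀ z ∈ closedBall c R, DifferentiableAt ℂ (logDeriv f) z := by
    intro z hz
    have h1 := hf.analyticAt (hU.mem_nhds (hsub hz))
    exact h1.deriv.differentiableAt.div h1.differentiableAt (h0 z hz)
  exact Complex.circleIntegral_eq_zero_of_differentiable_on_off_countable hR Set.countable_empty
    (fun z hz => (hd z hz).continuousAt.continuousWithinAt)
    (fun z hz => hd z (ball_subset_closedBall hz.1))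

/-- The argument principle for a function with a given factorization. -/
theorem circleIntegral_logDeriv_of_eq_prod_mul (hU : IsOpen U) {h : ℂ → ℂ}
    (hh : DifferentiableOn ℂ h U) (Z : Finset ℂ) (n : ℂ → ℕ)
    (hfh : ∀ z ∈ U, f z = (∏ u ∈ Z, (z - u) ^ n u) * h z)
    {c : ℂ} {ρ : ℝ} (hρ : 0 < ρ) (hsub : closedBall c ρ ⊆ U) (hh0 : ∀ z ∈ closedBall c ρ, h z ≠ 0)
    (hZ : ∀ u ∈ Z, u ∉ sphere c ρ) [DecidablePred (· ∈ ball c ρ)] :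
    (∮ z in C(c, ρ), logDeriv f z) =
      2 * Real.pi * Complex.I * ((∑ u ∈ Z with u ∈ ball c ρ, n u : ℕ) : ℂ) := by
  have hne : ∀ z ∈ sphere c ρ, ∀ u ∈ Z, z - u ≠ 0 := by
    intro z hz u hu h0
    rw [sub_eq_zero] at h0
    exact hZ u hu (h0 ▸ hz)
  have h1 : (∮ z in C(c, ρ), logDeriv f z) =
      ∮ z in C(c, ρ), ((∑ u ∈ Z, (n u : ℂ) * (z - u)⁻¹) + logDeriv h z) := by
    refine circleIntegral.integral_congr hρ.le fun z hz => ?_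
    have hzU := hsub (sphere_subset_closedBall hz)
    have he : f =ᶠ[𝓝 z] fun z => (∏ u ∈ Z, (z - u) ^ n u) * h z := by
      filter_upwards [hU.mem_nhds hzU] with w hw using hfh w hw
    rw [(logDeriv_congr_nhds he).eq_of_nhds]
    rw [logDeriv_mul (f := fun z => ∏ u ∈ Z, (z - u) ^ n u) z
      (Finset.prod_ne_zero_iff.2 fun u hu => pow_ne_zero _ (hne z hz u hu))
      (hh0 z (sphere_subset_closedBall hz)) (by fun_prop)
      ((hh z hzU).differentiableAt (hU.mem_nhds hzU))]
    congr 1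
    rw [logDeriv_prod (f := fun u z => (z - u) ^ n u)
      (fun u hu => pow_ne_zero _ (hne z hz u hu)) (fun u _ => by fun_prop)]
    refine Finset.sum_congr rfl fun u hu => ?_
    rw [logDeriv_fun_pow (f := fun z => z - u) (by fun_prop)]
    simp [logDeriv_apply]
  have hint : ∀ u ∈ Z, CircleIntegrable (fun z => (n u : ℂ) * (z - u)⁻¹) c ρ := by
    intro u hu
    refine ContinuousOn.circleIntegrable hρ.le fun z hz => ?_
    have := hne z hz u hu
    exact ContinuousAt.continuousWithinAt (by fun_prop (disch := assumption))
  have hinth : CircleIntegrable (logDeriv h) c ρ := by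
    refine ContinuousOn.circleIntegrable hρ.le fun z hz => ?_
    have hz' := sphere_subset_closedBall hz
    have h1 := hh.analyticAt (hU.mem_nhds (hsub hz'))
    exact (h1.deriv.continuousAt.div h1.continuousAt (hh0 z hz')).continuousWithinAt
  rw [h1, circleIntegral.integral_add (CircleIntegrable.fun_sum Z hint) hinth,
    circleIntegral_logDeriv_eq_zero hU hh hρ.le hsub hh0, add_zero,
    circleIntegral.integral_fun_sum hint, Finset.sum_filter, Nat.cast_sum, Finset.mul_sum]
  refine Finset.sum_congr rfl fun u hu => ?_
  rw [circleIntegral.integral_const_mul]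
  split_ifs with hub
  · rw [circleIntegral.integral_sub_inv_of_mem_ball hub]; ring
  · rw [circleIntegral_sub_inv_of_notMem_closedBall hρ.le]
    · simp
    · intro hcb
      rw [← ball_union_sphere] at hcb
      exact hcb.elim hub (hZ u hu)

/-- The disc is connected, so an accumulation of zeros would force `f` to vanish on all of it,
including the circle. -/
theorem eventually_ne_zero_nhdsNE_of_sphere (hU : IsOpen U) (hf : DifferentiableOn ℂ f U) {k : ℂ}
    {r : ℝ} (hr : 0 < r) (hsub : closedBall k r ⊆ U) (hs : ∀ z ∈ sphere k r, f z ≠ 0)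
    {z : ℂ} (hz : z ∈ closedBall k r) : ∀ᶠ w in 𝓝[≠] z, f w ≠ 0 := by
  have hfa : AnalyticOnNhd ℂ f (closedBall k r) := fun z hz => hf.analyticAt (hU.mem_nhds (hsub hz))
  by_contra hcon
  have h0 := hfa.eqOn_zero_of_preconnected_of_frequently_eq_zero
    (convex_closedBall k r).isPreconnected hz (fun h => hcon h)
  have hmem : k + r ∈ sphere k r := by simp [abs_of_pos hr]
  exact hs _ hmem (h0 (sphere_subset_closedBall hmem))

theorem finite_zeros_closedBall (hU : IsOpen U) (hf : DifferentiableOn ℂ f U) {k : ℂ}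
    {r : ℝ} (hr : 0 < r) (hsub : closedBall k r ⊆ U) (hs : ∀ z ∈ sphere k r, f z ≠ 0) :
    {z | z ∈ closedBall k r ∧ f z = 0}.Finite := by
  by_contra hinf
  obtain ⟨z, hz, hacc⟩ := Set.Infinite.exists_accPt_of_subset_isCompact hinf
    (isCompact_closedBall k r) fun z hz => hz.1
  have h1 := eventually_ne_zero_nhdsNE_of_sphere hU hf hr hsub hs hz
  have h2 := accPt_iff_frequently_nhdsNE.1 hacc
  obtain ⟨w, hw, hw'⟩ := (h2.and_eventually h1).exists
  exact hw' hw.2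

/-- The argument principle on all circles in a disc. -/
theorem exists_circleIntegral_logDeriv_eq_sum (hU : IsOpen U) (hf : DifferentiableOn ℂ f U) {k : ℂ}
    {r : ℝ} (hr : 0 < r) (hsub : closedBall k r ⊆ U) (hs : ∀ z ∈ sphere k r, f z ≠ 0) :
    ∃ (Z : Finset ℂ) (n : ℂ → ℕ), (∀ z, z ∈ Z ↔ z ∈ closedBall k r ∧ f z = 0) ∧
      (∀ u ∈ Z, n u ≠ 0) ∧
      ∀ (c : ℂ) (ρ : ℝ) [DecidablePred (· ∈ ball c ρ)], 0 < ρ → closedBall c ρ ⊆ closedBall k r →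
        (∀ z ∈ sphere c ρ, f z ≠ 0) →
        (∮ z in C(c, ρ), logDeriv f z) =
          2 * Real.pi * Complex.I * ((∑ u ∈ Z with u ∈ ball c ρ, n u : ℕ) : ℂ) := by
  have hfin := finite_zeros_closedBall hU hf hr hsub hs
  have hmem : ∀ z, z ∈ hfin.toFinset ↔ z ∈ closedBall k r ∧ f z = 0 := by simp
  have htop : ∀ u ∈ hfin.toFinset, u ∈ U ∧ analyticOrderAt f u ≠ ⊤ := by
    intro u hu
    have hu' := ((hmem u).1 hu).1
    refine ⟨hsub hu', fun h => ?_⟩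
    have h1 : ∀ᶠ w in 𝓝[≠] u, f w = 0 :=
      (analyticOrderAt_eq_top.1 h).filter_mono nhdsWithin_le_nhds
    obtain ⟨w, hw, hw'⟩ := ((eventually_ne_zero_nhdsNE_of_sphere hU hf hr hsub hs hu').and h1).exists
    exact hw hw'
  -- One factorization serves every circle, so the weights counted on the large circle are those
  -- seen by small circles around single zeros.
  obtain ⟨h, hh, hhZ, hfh⟩ := exists_eq_prod_sub_pow_mul hU hf _ htop
  refine ⟨hfin.toFinset, analyticOrderNatAt f, hmem, ?_, ?_⟩
  · intro u hu h0
    have hfa := hf.analyticAt (hU.mem_nhds (htop u hu).1)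
    have := Nat.cast_analyticOrderNatAt (htop u hu).2
    rw [h0] at this
    exact hfa.analyticOrderAt_eq_zero.1 this.symm ((hmem u).1 hu).2
  · intro c ρ _ hρ hc hsρ
    refine circleIntegral_logDeriv_of_eq_prod_mul hU hh _ _ hfh hρ (hc.trans hsub) ?_ ?_
    · intro z hz h0
      by_cases hzZ : z ∈ hfin.toFinset
      · exact hhZ z hzZ h0
      · exact hzZ ((hmem z).2 ⟨hc hz, by rw [hfh z (hsub (hc hz)), h0, mul_zero]⟩)
    · intro u hu hus
      exact hsρ u hus ((hmem u).1 hu).2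

/-- Local constancy of the number of zeros in a disc (Hurwitz). -/
theorem eventually_circleIntegral_logDeriv_eq (hU : IsOpen U) {A : Set ℂ} {d : ℂ → ℂ → ℂ} {a : ℂ}
    (hA : A ∈ 𝓝 a) (hdc : ContinuousOn (fun p : ℂ × ℂ => d p.1 p.2) (A ×ˢ U))
    (hdk : ∀ α ∈ A, DifferentiableOn ℂ (d α) U) {k : ℂ} {r : ℝ} (hr : 0 < r)
    (hsub : closedBall k r ⊆ U) (hs : ∀ z ∈ sphere k r, d a z ≠ 0) :
    ∀ᶠ α in 𝓝 a, (∀ z ∈ sphere k r, d α z ≠ 0) ∧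
      (∮ z in C(k, r), logDeriv (d α) z) = ∮ z in C(k, r), logDeriv (d a) z := by
  have ha : a ∈ A := mem_of_mem_nhds hA
  have hsU : sphere k r ⊆ U := sphere_subset_closedBall.trans hsub
  have hcont : ∀ z ∈ U, ContinuousAt (fun p : ℂ × ℂ => d p.1 p.2) (a, z) := fun z hz =>
    hdc.continuousAt (prod_mem_nhds hA (hU.mem_nhds hz))
  have hne : ∀ᶠ α in 𝓝 a, ∀ z ∈ sphere k r, d α z ≠ 0 :=
    (isCompact_sphere k r).eventually_forall_of_forall_eventually fun z hz =>
      (hcont z (hsU hz)).eventually_ne (hs z hz)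
  have hlim : TendstoLocallyUniformlyOn d (d a) (𝓝 a) U := by
    rw [tendstoLocallyUniformlyOn_iff_forall_tendsto]
    intro z hz
    have h1 : Tendsto (fun p : ℂ × ℂ => (d a p.2, d p.1 p.2)) (𝓝 a ×ˢ 𝓝[U] z)
        (𝓝 (d a z, d a z)) := by
      have h2 : Tendsto (fun p : ℂ × ℂ => d p.1 p.2) (𝓝 a ×ˢ 𝓝[U] z) (𝓝 (d a z)) := by
        have := (hcont z hz).tendsto
        rw [nhds_prod_eq] at this
        exact this.mono_left (prod_mono_right _ nhdsWithin_le_nhds)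
      have h3 : Tendsto (fun p : ℂ × ℂ => d a p.2) (𝓝 a ×ˢ 𝓝[U] z) (𝓝 (d a z)) :=
        ((hdk a ha).continuousOn z hz).tendsto.comp tendsto_snd
      exact h3.prodMk_nhds h2
    exact h1.mono_right (nhds_le_uniformity _)
  have hdiff : ∀ᶠ α in 𝓝 a, DifferentiableOn ℂ (d α) U := by
    filter_upwards [hA] with α hα using hdk α hα
  have hda : ContinuousOn (deriv (d a)) (sphere k r) := fun z hz =>
    ((hdk a ha).analyticAt (hU.mem_nhds (hsU hz))).deriv.continuousAt.continuousWithinAt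
  have hla : ContinuousOn (d a) (sphere k r) := (hdk a ha).continuousOn.mono hsU
  have hunif : TendstoUniformlyOn (fun α => logDeriv (d α)) (logDeriv (d a)) (𝓝 a)
      (sphere k r) := by
    rw [← tendstoLocallyUniformlyOn_iff_tendstoUniformlyOn_of_compact (isCompact_sphere k r)]
    -- Locally uniform convergence of holomorphic functions passes to derivatives, hence to
    -- logarithmic derivatives on the zero-free circle.
    have h1 := ((hlim.deriv hdiff hU).mono hsU).mul₀
      ((hlim.mono hsU).inv₀ hla hs) hda (hla.inv₀ hs)
    refine h1.congr fun α z _ => ?_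
    simp [logDeriv_apply, div_eq_mul_inv]
  have hcts : ∀ᶠ α in 𝓝 a, ContinuousOn (logDeriv (d α)) (sphere k r) := by
    filter_upwards [hdiff, hne] with α hα hα0 z hz
    have h1 := hα.analyticAt (hU.mem_nhds (hsU hz))
    exact (h1.deriv.continuousAt.div h1.continuousAt (hα0 z hz)).continuousWithinAt
  have hint := hunif.tendsto_circleIntegral_of_continuousOn hr.le hcts
  have hnat : ∀ α, DifferentiableOn ℂ (d α) U → (∀ z ∈ sphere k r, d α z ≠ 0) →
      ∃ N : ℕ, (∮ z in C(k, r), logDeriv (d α) z) = 2 * Real.pi * Complex.I * N := by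
    intro α hα hα0
    classical
    obtain ⟨Z, n, -, -, h⟩ := exists_circleIntegral_logDeriv_eq_sum hU hα hr hsub hα0
    exact ⟨_, h k r hr le_rfl hα0⟩
  obtain ⟨N₀, hN₀⟩ := hnat a (hdk a ha) hs
  -- Both integrals lie in `2πi ℕ`, whose points are `2π` apart, so closeness within `2π` forces
  -- equality.
  have hclose := Metric.tendsto_nhds.1 hint (2 * Real.pi) Real.two_pi_pos
  filter_upwards [hne, hdiff, hclose] with α hα0 hα hdist
  refine ⟨hα0, ?_⟩
  obtain ⟨N, hN⟩ := hnat α hα hα0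
  rw [hN, hN₀, dist_eq_norm, ← mul_sub, norm_mul] at hdist
  have hnorm : ‖(2 * Real.pi * Complex.I : ℂ)‖ = 2 * Real.pi := by
    simp [abs_of_pos Real.pi_pos]
  rw [hnorm] at hdist
  have hlt : ‖((N : ℤ) - (N₀ : ℤ) : ℂ)‖ < 1 := by
    have h2π := Real.two_pi_pos
    push_cast
    nlinarith
  rw [← Int.cast_sub, Complex.norm_intCast] at hlt
  have h0 : (N : ℤ) - N₀ = 0 := by
    rw [← Int.abs_lt_one_iff]
    exact_mod_cast hlt
  have : N = N₀ := by omega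
  rw [hN, hN₀, this]

end Scalar

end FlatBands

namespace FlatBands

open Metric Filter Topology ContinuousLinearMap

/-! ### Residues of operator products through a finite-dimensional space. -/

section ResidueTrace

variable {X V : Type*} [NormedAddCommGroup X] [NormedSpace ℂ X]
  [NormedAddCommGroup V] [NormedSpace ℂ V]

theorem circleIntegral_clm_apply {E F : Type*} [NormedAddCommGroup E] [NormedSpace ℂ E]
    [CompleteSpace E] [NormedAddCommGroup F] [NormedSpace ℂ F] [CompleteSpace F]
    (L : E →L[ℂ] F) {f : ℂ → E} {c : ℂ} {R : ℝ} (hf : CircleIntegrable f c R) :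
    (∮ z in C(c, R), L (f z)) = L (∮ z in C(c, R), f z) := by
  simp only [circleIntegral, ← map_smul]
  exact L.intervalIntegral_comp_comm hf.out

/-- Taylor expansion with a holomorphic remainder. -/
theorem exists_taylor_remainder {E : Type*} [NormedAddCommGroup E] [NormedSpace ℂ E]
    [CompleteSpace E] {U : Set ℂ} {k : ℂ} (hU : U ∈ 𝓝 k) (m : ℕ) {f : ℂ → E}
    (hf : DifferentiableOn ℂ f U) :
    ∃ (a : ℕ → E) (g : ℂ → E), DifferentiableOn ℂ g U ∧
      ∀ z, f z = (∑ i ∈ Finset.range m, (z - k) ^ i • a i) + (z - k) ^ m • g z := by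
  induction m with
  | zero => exact ⟨0, f, hf, by simp⟩
  | succ m ih =>
    obtain ⟨a, g, hg, hfg⟩ := ih
    refine ⟨Function.update a m (g k), dslope g k, (Complex.differentiableOn_dslope hU).2 hg,
      fun z => ?_⟩
    have h1 : g z = g k + (z - k) • dslope g k z := by
      rw [sub_smul_dslope]; abel
    rw [hfg z, Finset.sum_range_succ, h1, Function.update_self, smul_add, smul_smul, ← pow_succ,
      ← add_assoc]
    congr 2
    refine Finset.sum_congr rfl fun i hi => ?_
    rw [Function.update_of_ne (Finset.mem_range.1 hi).ne]

variable [FiniteDimensional ℂ V]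

/-- The whole sum factors through the single finite-dimensional space `Vᵐ`; this avoids any
additivity statement for the finite-rank trace. -/
theorem finiteRankTrace_sum_comp (m : ℕ) (a : ℕ → V →L[ℂ] X) (c : ℕ → X →L[ℂ] V) :
    finiteRankTrace (∑ i ∈ Finset.range m, a i ∘L c i) =
      ∑ i ∈ Finset.range m, LinearMap.trace ℂ V (c i ∘L a i : V →L[ℂ] V) := by
  let a' : (Fin m → V) →L[ℂ] X := ∑ i : Fin m, a i ∘L ContinuousLinearMap.proj i
  let c' : X →L[ℂ] (Fin m → V) := ContinuousLinearMap.pi fun i => c i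
  have h1 : ∑ i ∈ Finset.range m, a i ∘L c i = a' ∘L c' := by
    rw [← Fin.sum_univ_eq_sum_range (fun i => a i ∘L c i)]
    ext x
    simp [a', c']
  have h2 : ((c' ∘L a' : (Fin m → V) →L[ℂ] (Fin m → V)) : (Fin m → V) →ₗ[ℂ] (Fin m → V)) =
      ∑ i : Fin m, ((c' : X →ₗ[ℂ] (Fin m → V)) ∘ₗ (a i : V →ₗ[ℂ] X)) ∘ₗ LinearMap.proj i := by
    ext x
    simp [a']
  rw [h1, finiteRankTrace_comp, h2, map_sum,
    ← Fin.sum_univ_eq_sum_range (fun i => LinearMap.trace ℂ V (c i ∘L a i : V →L[ℂ] V))]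
  refine Finset.sum_congr rfl fun i _ => ?_
  rw [LinearMap.trace_comp_comm']
  rfl

/-- The trace on endomorphisms of a finite-dimensional space as a bounded functional. -/
noncomputable def traceL (V : Type*) [NormedAddCommGroup V] [NormedSpace ℂ V]
    [FiniteDimensional ℂ V] : (V →L[ℂ] V) →L[ℂ] ℂ :=
  LinearMap.toContinuousLinearMap
    ((LinearMap.trace ℂ V) ∘ₗ (ContinuousLinearMap.coeLM ℂ : (V →L[ℂ] V) →ₗ[ℂ] (V →ₗ[ℂ] V)))

/-- The trace of the residue of a product `A B` that factors through a finite-dimensional space is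
the residue of the trace of `B A`. -/
theorem finiteRankTrace_circleIntegral_pow_inv_smul [CompleteSpace X] {U : Set ℂ} (hU : IsOpen U)
    {k : ℂ} {r : ℝ} (hr : 0 < r) (hsub : closedBall k r ⊆ U) (m : ℕ) {A : ℂ → V →L[ℂ] X}
    {B : ℂ → X →L[ℂ] V} (hA : DifferentiableOn ℂ A U) (hB : DifferentiableOn ℂ B U) :
    finiteRankTrace (∮ ζ in C(k, r), ((ζ - k) ^ m)⁻¹ • (A ζ ∘L B ζ)) =
      ∮ ζ in C(k, r), ((ζ - k) ^ m)⁻¹ * traceL V (B ζ ∘L A ζ) := by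
  have : CompleteSpace V := FiniteDimensional.complete ℂ V
  -- Expanding `A` to order `m` separates a finite sum from a remainder that cancels the pole and
  -- integrates to zero. Both sides then reduce to the same moments of `B`, composed with the
  -- coefficients `a i` in opposite orders.
  obtain ⟨a, g, hg, hAg⟩ := exists_taylor_remainder
    (hU.mem_nhds (hsub (mem_closedBall_self hr.le))) m hA
  have hsU : sphere k r ⊆ U := sphere_subset_closedBall.trans hsub
  have hne : ∀ ζ ∈ sphere k r, (ζ - k) ^ m ≠ 0 := fun ζ hζ =>
    pow_ne_zero _ (sub_ne_zero.2 (ne_of_mem_sphere hζ hr.ne'))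
  have hcinv : ContinuousOn (fun ζ : ℂ => ((ζ - k) ^ m)⁻¹) (sphere k r) :=
    ContinuousOn.inv₀ (by fun_prop) hne
  let w : ℕ → ℂ → X →L[ℂ] V := fun i ζ => (((ζ - k) ^ m)⁻¹ * (ζ - k) ^ i) • B ζ
  have hw : ∀ i, CircleIntegrable (w i) k r := fun i =>
    ((hcinv.mul (by fun_prop)).smul (hB.continuousOn.mono hsU)).circleIntegrable hr.le
  have hgB : DifferentiableOn ℂ (fun ζ => g ζ ∘L B ζ) U := hg.clm_comp hB
  have hBg : DifferentiableOn ℂ (fun ζ => traceL V (B ζ ∘L g ζ)) U :=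
    (traceL V).differentiable.comp_differentiableOn (hB.clm_comp hg)
  have hLeft : (∮ ζ in C(k, r), ((ζ - k) ^ m)⁻¹ • (A ζ ∘L B ζ)) =
      ∑ i ∈ Finset.range m, a i ∘L (∮ ζ in C(k, r), w i ζ) := by
    have h1 : (∮ ζ in C(k, r), ((ζ - k) ^ m)⁻¹ • (A ζ ∘L B ζ)) =
        ∮ ζ in C(k, r), ((∑ i ∈ Finset.range m, compL ℂ X V X (a i) (w i ζ)) + g ζ ∘L B ζ) := by
      refine circleIntegral.integral_congr hr.le fun ζ hζ => ?_
      have h0 := hne ζ hζ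
      ext x
      simp only [hAg ζ, w, compL_apply, _root_.add_apply,
        _root_.smul_apply, ContinuousLinearMap.comp_apply, smul_add,
        _root_.sum_apply, map_smul, smul_smul, Finset.smul_sum,
        inv_mul_cancel₀ h0, one_smul]
    have hL : ∀ i ∈ Finset.range m,
        CircleIntegrable (fun ζ => compL ℂ X V X (a i) (w i ζ)) k r := fun i _ =>
      ((compL ℂ X V X (a i)).continuous.comp_continuousOn
        ((hcinv.mul (by fun_prop)).smul (hB.continuousOn.mono hsU))).circleIntegrable hr.le
    rw [h1, circleIntegral.integral_add (CircleIntegrable.fun_sum _ hL)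
      ((hgB.continuousOn.mono hsU).circleIntegrable hr.le),
      circleIntegral_eq_zero_of_differentiableOn hU hr.le hsub hgB, add_zero,
      circleIntegral.integral_fun_sum hL]
    refine Finset.sum_congr rfl fun i _ => ?_
    rw [circleIntegral_clm_apply _ (hw i)]
    rfl
  let L : ℕ → (X →L[ℂ] V) →L[ℂ] ℂ := fun i => traceL V ∘L (compL ℂ V X V).flip (a i)
  have hL : ∀ i ∈ Finset.range m, CircleIntegrable (fun ζ => L i (w i ζ)) k r := fun i _ =>
    ((L i).continuous.comp_continuousOn
      ((hcinv.mul (by fun_prop)).smul (hB.continuousOn.mono hsU))).circleIntegrable hr.le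
  have hRight : (∮ ζ in C(k, r), ((ζ - k) ^ m)⁻¹ * traceL V (B ζ ∘L A ζ)) =
      ∑ i ∈ Finset.range m, L i (∮ ζ in C(k, r), w i ζ) := by
    have h1 : (∮ ζ in C(k, r), ((ζ - k) ^ m)⁻¹ * traceL V (B ζ ∘L A ζ)) =
        ∮ ζ in C(k, r), ((∑ i ∈ Finset.range m, L i (w i ζ)) + traceL V (B ζ ∘L g ζ)) := by
      refine circleIntegral.integral_congr hr.le fun ζ hζ => ?_
      have h0 := hne ζ hζ
      have h2 : B ζ ∘L A ζ = (∑ i ∈ Finset.range m, (ζ - k) ^ i • (B ζ ∘L a i)) +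
          (ζ - k) ^ m • (B ζ ∘L g ζ) := by
        ext x
        simp [hAg ζ]
      simp only [h2, map_add, map_sum, map_smul, smul_eq_mul, mul_add, Finset.mul_sum]
      rw [inv_mul_cancel_left₀ h0]
      congr 1
      refine Finset.sum_congr rfl fun i _ => ?_
      simp only [L, w, ContinuousLinearMap.comp_apply, map_smul, smul_eq_mul, flip_apply,
        compL_apply, mul_assoc]
    rw [h1, circleIntegral.integral_add (CircleIntegrable.fun_sum _ hL)
      ((hBg.continuousOn.mono hsU).circleIntegrable hr.le),
      circleIntegral_eq_zero_of_differentiableOn hU hr.le hsub hBg, add_zero,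
      circleIntegral.integral_fun_sum hL]
    refine Finset.sum_congr rfl fun i _ => ?_
    rw [circleIntegral_clm_apply _ (hw i)]
  rw [hLeft, hRight, finiteRankTrace_sum_comp]
  rfl

end ResidueTrace

/-! ### Reduction of an operator family to a finite determinant. -/

section Schur

variable {X Y : Type*} [NormedAddCommGroup X] [NormedSpace ℂ X]
  [NormedAddCommGroup Y] [NormedSpace ℂ Y] {n : ℕ}

/-- The effective operator `1 - p (T + q p)⁻¹ q` on `ℂⁿ`, which is invertible if and only if
`T` is. -/
noncomputable def effectiveOp (p : X →L[ℂ] (Fin n → ℂ)) (q : (Fin n → ℂ) →L[ℂ] Y) (T : X →L[ℂ] Y) :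
    (Fin n → ℂ) →L[ℂ] (Fin n → ℂ) :=
  ContinuousLinearMap.id ℂ _ - p ∘L (T + q ∘L p).inverse ∘L q

/-- The determinant of the effective operator. -/
noncomputable def effectiveDet (p : X →L[ℂ] (Fin n → ℂ)) (q : (Fin n → ℂ) →L[ℂ] Y)
    (T : X →L[ℂ] Y) : ℂ :=
  LinearMap.det (effectiveOp p q T : (Fin n → ℂ) →ₗ[ℂ] (Fin n → ℂ))

variable {p : X →L[ℂ] (Fin n → ℂ)} {q : (Fin n → ℂ) →L[ℂ] Y} {T : X →L[ℂ] Y}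

/-- The operator `1 + p T⁻¹ q` is a right inverse of the effective operator. -/
theorem effectiveDet_ne_zero (hE : (T + q ∘L p).IsInvertible) (hT : T.IsInvertible) :
    effectiveDet p q T ≠ 0 := by
  obtain ⟨e, he⟩ := hE
  obtain ⟨t, rfl⟩ := hT
  have hinv : ((t : X →L[ℂ] Y) + q ∘L p).inverse = e.symm := by
    rw [← he, ContinuousLinearMap.inverse_equiv]
  have he' : ∀ x, e x = t x + q (p x) := fun x => by
    have := congrArg (fun f : X →L[ℂ] Y => f x) he
    simpa using this
  have hmul : effectiveOp p q (t : X →L[ℂ] Y) ∘L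
      (ContinuousLinearMap.id ℂ _ + p ∘L (t.symm : Y →L[ℂ] X) ∘L q) =
      ContinuousLinearMap.id ℂ _ := by
    apply ContinuousLinearMap.ext
    intro v
    have h1 : q (p (t.symm (q v))) = e (t.symm (q v)) - q v := by rw [he']; simp
    simp only [effectiveOp, hinv, ContinuousLinearMap.comp_apply, _root_.sub_apply,
      _root_.add_apply, ContinuousLinearMap.id_apply, map_add, h1,
      ContinuousLinearEquiv.coe_coe, map_sub, ContinuousLinearEquiv.symm_apply_apply]
    abel
  have h2 := congrArg (fun f : (Fin n → ℂ) →L[ℂ] (Fin n → ℂ) =>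
    LinearMap.det (f : (Fin n → ℂ) →ₗ[ℂ] (Fin n → ℂ))) hmul
  simp only [ContinuousLinearMap.toLinearMap_comp, LinearMap.det_comp,
    ContinuousLinearMap.coe_id, LinearMap.det_id] at h2
  exact left_ne_zero_of_mul_eq_one h2

/-- This is the Woodbury formula. With `H = (T + q p)⁻¹` and `M` the effective operator, it rests on
the intertwining relations `T H q = q M` and `p H T = M p`. Writing `M⁻¹` through the adjugate
confines the singularity to a scalar. -/
theorem isInvertible_and_inverse_eq (hE : (T + q ∘L p).IsInvertible)
    (hd : effectiveDet p q T ≠ 0) :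
    T.IsInvertible ∧ T.inverse = (T + q ∘L p).inverse + (effectiveDet p q T)⁻¹ •
      (((T + q ∘L p).inverse ∘L q) ∘L
        (adjugateL (effectiveOp p q T) ∘L p ∘L (T + q ∘L p).inverse)) := by
  obtain ⟨e, he⟩ := hE
  have hinv : (T + q ∘L p).inverse = e.symm := by
    rw [← he, ContinuousLinearMap.inverse_equiv]
  have hT : ∀ x, T x = e x - q (p x) := fun x => by
    have := congrArg (fun f : X →L[ℂ] Y => f x) he
    simp only [_root_.add_apply, ContinuousLinearMap.comp_apply,
      ContinuousLinearEquiv.coe_coe] at this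
    rw [this]; simp
  set δ := effectiveDet p q T with hδ
  set M := effectiveOp p q T with hM
  have hMv : ∀ v, M v = v - p (e.symm (q v)) := fun v => by
    simp [hM, effectiveOp, hinv]
  have hMa : ∀ v, M (adjugateL M v) = δ • v := fun v => by
    have := congrArg (fun f : (Fin n → ℂ) →L[ℂ] (Fin n → ℂ) => f v) (comp_adjugateL M)
    exact this
  have haM : ∀ v, adjugateL M (M v) = δ • v := fun v => by
    have := congrArg (fun f : (Fin n → ℂ) →L[ℂ] (Fin n → ℂ) => f v) (adjugateL_comp M)
    exact this
  rw [hinv]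
  set G : Y →L[ℂ] X := (e.symm : Y →L[ℂ] X) + δ⁻¹ • (((e.symm : Y →L[ℂ] X) ∘L q) ∘L
        (adjugateL M ∘L p ∘L (e.symm : Y →L[ℂ] X))) with hG
  have hGy : ∀ y, G y = e.symm y + δ⁻¹ • e.symm (q (adjugateL M (p (e.symm y)))) := fun y => by
    simp [hG]
  have h1 : T ∘L G = ContinuousLinearMap.id ℂ Y := by
    apply ContinuousLinearMap.ext
    intro y
    have hTH : ∀ v, T (e.symm (q v)) = q (M v) := fun v => by
      rw [hT, hMv, map_sub]; simp
    rw [ContinuousLinearMap.comp_apply, hGy, map_add, map_smul, hTH, hMa, map_smul, smul_smul,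
      inv_mul_cancel₀ hd, one_smul, hT]
    simp
  have h2 : G ∘L T = ContinuousLinearMap.id ℂ X := by
    apply ContinuousLinearMap.ext
    intro x
    have hHT : e.symm (T x) = x - e.symm (q (p x)) := by rw [hT, map_sub]; simp
    rw [ContinuousLinearMap.comp_apply, hGy, hHT, map_sub p, ← hMv, haM, map_smul, map_smul,
      smul_smul, inv_mul_cancel₀ hd, one_smul]
    simp
  exact ⟨.of_inverse h1 h2, ContinuousLinearMap.inverse_eq h1 h2⟩

theorem isInvertible_iff_effectiveDet_ne_zero (hE : (T + q ∘L p).IsInvertible) :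
    T.IsInvertible ↔ effectiveDet p q T ≠ 0 :=
  ⟨effectiveDet_ne_zero hE, fun h => (isInvertible_and_inverse_eq hE h).1⟩

variable [CompleteSpace X]

theorem differentiableAt_effectiveOp (hE : (T + q ∘L p).IsInvertible) :
    DifferentiableAt ℂ (effectiveOp p q) T := by
  have h1 : DifferentiableAt ℂ (fun S : X →L[ℂ] Y => (S + q ∘L p).inverse) T :=
    DifferentiableAt.comp (f := fun S : X →L[ℂ] Y => S + q ∘L p) T
      ((hE.contDiffAt_map_inverse (n := 1)).differentiableAt one_ne_zero)
      (differentiableAt_id.add_const _)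
  exact (differentiableAt_const _).sub
    ((differentiableAt_const _).clm_comp (h1.clm_comp (differentiableAt_const _)))

theorem differentiableAt_effectiveDet (hE : (T + q ∘L p).IsInvertible) :
    DifferentiableAt ℂ (effectiveDet p q) T :=
  DifferentiableAt.comp (g := fun M : (Fin n → ℂ) →L[ℂ] (Fin n → ℂ) =>
    LinearMap.det (M : (Fin n → ℂ) →ₗ[ℂ] (Fin n → ℂ))) T (differentiable_det _) (differentiableAt_effectiveOp hE)

variable {F : ℂ → X →L[ℂ] Y}

theorem eventually_isInvertible {Z : Type*} [TopologicalSpace Z] {S : Z → X →L[ℂ] Y} {z : Z}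
    (hS : ContinuousAt S z) (hz : (S z).IsInvertible) : ∀ᶠ w in 𝓝 z, (S w).IsInvertible :=
  hS.eventually (ContinuousLinearEquiv.isOpen.mem_nhds hz)

theorem differentiableAt_inverse {z : ℂ} (hF : DifferentiableAt ℂ F z) (hz : (F z).IsInvertible) :
    DifferentiableAt ℂ (fun ζ => (F ζ).inverse) z :=
  DifferentiableAt.comp z ((hz.contDiffAt_map_inverse (n := 1)).differentiableAt one_ne_zero) hF

/-- Differentiate `F⁻¹ F = 1`, which holds near `z` because invertibility is an open condition. -/
theorem hasDerivAt_inverse {F' : X →L[ℂ] Y} {z : ℂ} (hF : HasDerivAt F F' z)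
    (hz : (F z).IsInvertible) :
    HasDerivAt (fun ζ => (F ζ).inverse) (-((F z).inverse ∘L F' ∘L (F z).inverse)) z := by
  have hG := (differentiableAt_inverse hF.differentiableAt hz).hasDerivAt
  set G' := deriv (fun ζ => (F ζ).inverse) z
  have h1 := hG.clm_comp hF
  have h2 : (fun ζ => (F ζ).inverse ∘L F ζ) =ᶠ[𝓝 z] fun _ => ContinuousLinearMap.id ℂ X := by
    filter_upwards [eventually_isInvertible hF.continuousAt hz] with ζ hζ
    exact hζ.inverse_comp_self
  have h3 := h1.unique ((hasDerivAt_const z _).congr_of_eventuallyEq h2)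
  have h4 : G' = -((F z).inverse ∘L F' ∘L (F z).inverse) := by
    have h5 := congrArg (fun S : X →L[ℂ] X => S ∘L (F z).inverse) h3
    simp only [ContinuousLinearMap.add_comp, ContinuousLinearMap.comp_assoc,
      hz.self_comp_inverse, ContinuousLinearMap.comp_id, ContinuousLinearMap.zero_comp] at h5
    exact eq_neg_of_add_eq_zero_left h5
  rwa [h4] at hG

theorem deriv_effectiveOp {z : ℂ} (hF : DifferentiableAt ℂ F z)
    (hE : (F z + q ∘L p).IsInvertible) :
    deriv (fun ζ => effectiveOp p q (F ζ)) z =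
      p ∘L (F z + q ∘L p).inverse ∘L deriv F z ∘L (F z + q ∘L p).inverse ∘L q := by
  have h1 : HasDerivAt (fun ζ => F ζ + q ∘L p) (deriv F z) z := hF.hasDerivAt.add_const _
  have h2 := hasDerivAt_inverse h1 hE
  have h3 := (((hasDerivAt_const z p).clm_comp
    (h2.clm_comp (hasDerivAt_const z q))).const_sub (ContinuousLinearMap.id ℂ (Fin n → ℂ))).deriv
  refine h3.trans ?_
  ext v i
  simp

/-- The logarithmic residue of an operator family is that of the determinant of its effective
operator. -/
theorem logResidueTrace_eq_circleIntegral_logDeriv [CompleteSpace Y]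
    (hF : Differentiable ℂ F) {U : Set ℂ} (hU : IsOpen U)
    (hE : ∀ ζ ∈ U, (F ζ + q ∘L p).IsInvertible) {k : ℂ} {r : ℝ} (hsub : closedBall k r ⊆ U)
    (hr : IsIsolatingRadius F k r) :
    logResidueTrace F k r = (2 * Real.pi * Complex.I)⁻¹ *
      ∮ ζ in C(k, r), logDeriv (fun ζ => effectiveDet p q (F ζ)) ζ := by
  obtain ⟨hr0, hriso⟩ := hr
  set d : ℂ → ℂ := fun ζ => effectiveDet p q (F ζ) with hd_def
  set H : ℂ → Y →L[ℂ] X := fun ζ => (F ζ + q ∘L p).inverse with hH_def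
  set M : ℂ → (Fin n → ℂ) →L[ℂ] (Fin n → ℂ) := fun ζ => effectiveOp p q (F ζ) with hM_def
  have hd : DifferentiableOn ℂ d U := fun ζ hζ =>
    ((differentiableAt_effectiveDet (hE ζ hζ)).comp ζ (hF ζ)).differentiableWithinAt
  have hM : DifferentiableOn ℂ M U := fun ζ hζ =>
    ((differentiableAt_effectiveOp (hE ζ hζ)).comp ζ (hF ζ)).differentiableWithinAt
  have hH : DifferentiableOn ℂ H U := fun ζ hζ =>
    (differentiableAt_inverse (F := fun ζ => F ζ + q ∘L p) ((hF ζ).add_const _)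
      (hE ζ hζ)).differentiableWithinAt
  have hF' : Differentiable ℂ (deriv F) := fun ζ => ((hF.analyticAt ζ).deriv).differentiableAt
  have hkU : k ∈ U := hsub (mem_closedBall_self hr0.le)
  have hd0 : ∀ ζ ∈ closedBall k r, ζ ≠ k → d ζ ≠ 0 := fun ζ hζ hne =>
    effectiveDet_ne_zero (hE ζ (hsub hζ)) (hriso ζ hζ hne)
  have hds : ∀ ζ ∈ sphere k r, d ζ ≠ 0 := fun ζ hζ =>
    hd0 ζ (sphere_subset_closedBall hζ) (ne_of_mem_sphere hζ hr0.ne')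
  have htop : analyticOrderAt d k ≠ ⊤ := fun h => by
    have h1 : ∀ᶠ w in 𝓝[≠] k, d w = 0 :=
      (analyticOrderAt_eq_top.1 h).filter_mono nhdsWithin_le_nhds
    obtain ⟨w, hw, hw'⟩ := ((eventually_ne_zero_nhdsNE_of_sphere hU hd hr0 hsub hds
      (mem_closedBall_self hr0.le)).and h1).exists
    exact hw hw'
  set m := analyticOrderNatAt d k
  obtain ⟨h, hh, hhk, hdh⟩ := exists_eq_sub_pow_mul hU hkU hd
    (Nat.cast_analyticOrderNatAt htop).symm
  have hh0 : ∀ ζ ∈ closedBall k r, h ζ ≠ 0 := by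
    intro ζ hζ h0
    by_cases hne : ζ = k
    · exact hhk (hne ▸ h0)
    · exact hd0 ζ hζ hne (by rw [hdh ζ (hsub hζ), h0, mul_zero])
  -- On `U'` the cofactor `h` is invertible, so the pole of `1 / d` is exactly `(ζ - k)⁻ᵐ` and both
  -- `A` and `B` below are holomorphic.
  set U' : Set ℂ := U ∩ h ⁻¹' {0}ᶜ with hU'_def
  have hU' : IsOpen U' := hh.continuousOn.isOpen_inter_preimage hU isOpen_compl_singleton
  have hsub' : closedBall k r ⊆ U' := fun ζ hζ => ⟨hsub hζ, hh0 ζ hζ⟩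
  have hUU : U' ⊆ U := Set.inter_subset_left
  set A : ℂ → (Fin n → ℂ) →L[ℂ] X := fun ζ => H ζ ∘L q with hA_def
  set B : ℂ → X →L[ℂ] (Fin n → ℂ) := fun ζ =>
    (h ζ)⁻¹ • (adjugateL (M ζ) ∘L p ∘L H ζ ∘L deriv F ζ) with hB_def
  have hA : DifferentiableOn ℂ A U' := (hH.mono hUU).clm_comp (differentiableOn_const _)
  have hB : DifferentiableOn ℂ B U' := by
    refine DifferentiableOn.fun_smul ((hh.mono hUU).fun_inv fun ζ hζ => hζ.2) ?_
    exact (differentiable_adjugateL.comp_differentiableOn (hM.mono hUU)).clm_comp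
      ((differentiableOn_const _).clm_comp ((hH.mono hUU).clm_comp hF'.differentiableOn))
  have hpow : ∀ ζ ∈ sphere k r, (ζ - k) ^ m ≠ 0 := fun ζ hζ =>
    pow_ne_zero _ (sub_ne_zero.2 (ne_of_mem_sphere hζ hr0.ne'))
  have hdinv : ∀ ζ ∈ sphere k r, (d ζ)⁻¹ = ((ζ - k) ^ m)⁻¹ * (h ζ)⁻¹ := fun ζ hζ => by
    rw [hdh ζ (hsub (sphere_subset_closedBall hζ)), mul_inv]
  have hHF : DifferentiableOn ℂ (fun ζ => H ζ ∘L deriv F ζ) U :=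
    hH.clm_comp hF'.differentiableOn
  have hsU' : sphere k r ⊆ U' := sphere_subset_closedBall.trans hsub'
  -- By the Woodbury formula the integrand is the holomorphic term `H F'` plus a term that factors
  -- through `ℂⁿ`; the former integrates to zero.
  have hint : (∮ ζ in C(k, r), (F ζ).inverse ∘L deriv F ζ) =
      ∮ ζ in C(k, r), ((ζ - k) ^ m)⁻¹ • (A ζ ∘L B ζ) := by
    have h1 : (∮ ζ in C(k, r), (F ζ).inverse ∘L deriv F ζ) =
        ∮ ζ in C(k, r), (H ζ ∘L deriv F ζ + ((ζ - k) ^ m)⁻¹ • (A ζ ∘L B ζ)) := by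
      refine circleIntegral.integral_congr hr0.le fun ζ hζ => ?_
      have hinv := (isInvertible_and_inverse_eq
        (hE ζ (hsub (sphere_subset_closedBall hζ))) (hds ζ hζ)).2
      have hdi : (effectiveDet p q (F ζ))⁻¹ = ((ζ - k) ^ m)⁻¹ * (h ζ)⁻¹ := hdinv ζ hζ
      simp only [hinv, hdi, hA_def, hB_def, hH_def, hM_def]
      ext x
      simp [smul_smul]
    have h2 : ContinuousOn (fun ζ => ((ζ - k) ^ m)⁻¹ • (A ζ ∘L B ζ)) (sphere k r) :=
      (ContinuousOn.inv₀ (by fun_prop) hpow).smul ((hA.clm_comp hB).continuousOn.mono hsU')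
    rw [h1, circleIntegral.integral_add
      ((hHF.continuousOn.mono (sphere_subset_closedBall.trans hsub)).circleIntegrable hr0.le)
      (h2.circleIntegrable hr0.le),
      circleIntegral_eq_zero_of_differentiableOn hU hr0.le hsub hHF, zero_add]
  unfold logResidueTrace
  rw [hint, finiteRankTrace_circleIntegral_pow_inv_smul hU' hr0 hsub' m hA hB]
  congr 1
  refine circleIntegral.integral_congr hr0.le fun ζ hζ => ?_
  have hζU := hsub (sphere_subset_closedBall hζ)
  -- Reversing the product puts `H F' H` between `p` and `q`, which is the derivative of the
  -- effective operator; Jacobi's formula then gives `d' / d`.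
  have hjac := deriv_det_comp (M := M) ((hM ζ hζU).differentiableAt (hU.mem_nhds hζU)) (hds ζ hζ)
  rw [deriv_effectiveOp (hF ζ) (hE ζ hζU)] at hjac
  change _ = deriv d ζ / d ζ
  have hjac' : deriv d ζ = traceL (Fin n → ℂ) (adjugateL (M ζ) ∘L p ∘L H ζ ∘L deriv F ζ ∘L
      H ζ ∘L q) := hjac
  have hBA : B ζ ∘L A ζ = (h ζ)⁻¹ • (adjugateL (M ζ) ∘L p ∘L H ζ ∘L deriv F ζ ∘L
      H ζ ∘L q) := by
    simp only [hA_def, hB_def]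
    ext v i
    simp
  simp only [hBA, map_smul, smul_eq_mul]
  rw [div_eq_mul_inv, hdinv ζ hζ, hjac']
  ring

end Schur

end FlatBands

namespace FlatBands

open Metric Filter Topology ContinuousLinearMap

/-! ### Local determinants and multiplicities of the family. -/

section Family

variable {X Y : Type*} [NormedAddCommGroup X] [NormedSpace ℂ X]
  [NormedAddCommGroup Y] [NormedSpace ℂ Y]
  {Ω : Set ℂ} {Q : ℂ → ℂ → X →L[ℂ] Y}

theorem differentiable_slice (hol : DifferentiableOn ℂ (fun p : ℂ × ℂ => Q p.1 p.2) (Ω ×ˢ Set.univ))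
    (hΩ : IsOpen Ω) {α : ℂ} (hα : α ∈ Ω) : Differentiable ℂ (Q α) := by
  intro k
  have h1 : DifferentiableAt ℂ (fun p : ℂ × ℂ => Q p.1 p.2) (α, k) :=
    hol.differentiableAt ((hΩ.prod isOpen_univ).mem_nhds ⟨hα, trivial⟩)
  exact h1.comp k ((differentiableAt_const α).prodMk differentiableAt_id)

theorem exists_isIsolatingRadius {F : ℂ → X →L[ℂ] Y} {k : ℂ}
    (h : ∀ᶠ ζ in 𝓝[≠] k, (F ζ).IsInvertible) {ε : ℝ} (hε : 0 < ε) :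
    ∃ r < ε, IsIsolatingRadius F k r := by
  rw [eventually_nhdsWithin_iff, Metric.eventually_nhds_iff_ball] at h
  obtain ⟨δ, hδ, hball⟩ := h
  refine ⟨min (δ / 2) (ε / 2), (min_le_right _ _).trans_lt (half_lt_self hε), by positivity, ?_⟩
  intro ζ hζ hne
  refine hball ζ ?_ hne
  exact (mem_closedBall.1 hζ).trans_lt ((min_le_left _ _).trans_lt (half_lt_self hδ))

theorem IsIsolatingRadius.mono {F : ℂ → X →L[ℂ] Y} {k : ℂ} {r ρ : ℝ}
    (h : IsIsolatingRadius F k r) (hρ : 0 < ρ) (hle : ρ ≤ r) : IsIsolatingRadius F k ρ :=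
  ⟨hρ, fun ζ hζ hne => h.2 ζ (closedBall_subset_closedBall hle hζ) hne⟩

variable [CompleteSpace X] [CompleteSpace Y]

/-- Near every point, the family is governed by a scalar holomorphic function `d`. -/
theorem exists_local_determinant (hΩ : IsOpen Ω)
    (hol : DifferentiableOn ℂ (fun p : ℂ × ℂ => Q p.1 p.2) (Ω ×ˢ Set.univ))
    (fred : ∀ α ∈ Ω, ∀ k : ℂ, IsFredholmIndexZero (Q α k)) {α₁ : ℂ} (hα₁ : α₁ ∈ Ω) (k₁ : ℂ) :
    ∃ ε > 0, ∃ d : ℂ → ℂ → ℂ, ball α₁ ε ⊆ Ω ∧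
      DifferentiableOn ℂ (fun p : ℂ × ℂ => d p.1 p.2) (ball α₁ ε ×ˢ ball k₁ ε) ∧
      (∀ α ∈ ball α₁ ε, ∀ k ∈ ball k₁ ε, (Q α k).IsInvertible ↔ d α k ≠ 0) ∧
      ∀ α ∈ ball α₁ ε, ∀ (k : ℂ) (r : ℝ), closedBall k r ⊆ ball k₁ ε →
        IsIsolatingRadius (Q α) k r →
        logResidueTrace (Q α) k r =
          (2 * Real.pi * Complex.I)⁻¹ * ∮ ζ in C(k, r), logDeriv (d α) ζ := by
  obtain ⟨n, p, q, hpq⟩ := (fred α₁ hα₁ k₁).exists_isInvertible_add_comp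
  have hdiff : ∀ z ∈ Ω ×ˢ (Set.univ : Set ℂ),
      DifferentiableAt ℂ (fun p : ℂ × ℂ => Q p.1 p.2) z := fun z hz =>
    hol.differentiableAt ((hΩ.prod isOpen_univ).mem_nhds hz)
  -- The correction chosen at `(α₁, k₁)` is kept fixed; it still works nearby because invertibility
  -- is open.
  have h1 : ∀ᶠ z : ℂ × ℂ in 𝓝 (α₁, k₁), (Q z.1 z.2 + q ∘L p).IsInvertible :=
    eventually_isInvertible (S := fun z : ℂ × ℂ => Q z.1 z.2 + q ∘L p)
      ((hdiff (α₁, k₁) ⟨hα₁, trivial⟩).continuousAt.add continuousAt_const) hpq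
  have h2 : ∀ᶠ z : ℂ × ℂ in 𝓝 (α₁, k₁), z.1 ∈ Ω :=
    continuousAt_fst.eventually (hΩ.mem_nhds hα₁)
  obtain ⟨ε, hε, hball⟩ := Metric.eventually_nhds_iff_ball.1 (h1.and h2)
  rw [← ball_prod_same] at hball
  have hk₁ : k₁ ∈ ball k₁ ε := mem_ball_self hε
  have hsubΩ : ball α₁ ε ⊆ Ω := fun α hα => (hball (α, k₁) ⟨hα, hk₁⟩).2
  refine ⟨ε, hε, fun α k => effectiveDet p q (Q α k), hsubΩ, ?_, ?_, ?_⟩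
  · intro z hz
    have h3 := (differentiableAt_effectiveDet (hball z hz).1).comp z
      (hdiff z ⟨(hball z hz).2, trivial⟩)
    exact h3.differentiableWithinAt
  · intro α hα k hk
    exact isInvertible_iff_effectiveDet_ne_zero (hball (α, k) ⟨hα, hk⟩).1
  · intro α hα k r hsub hr
    exact logResidueTrace_eq_circleIntegral_logDeriv (differentiable_slice hol hΩ (hsubΩ hα))
      isOpen_ball (fun ζ hζ => (hball (α, ζ) ⟨hα, hζ⟩).1) hsub hr

theorem differentiableOn_slice {d : ℂ → ℂ → ℂ} {s t : Set ℂ}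
    (hd : DifferentiableOn ℂ (fun p : ℂ × ℂ => d p.1 p.2) (s ×ˢ t)) {α : ℂ} (hα : α ∈ s) :
    DifferentiableOn ℂ (d α) t :=
  hd.comp (f := fun k : ℂ => (α, k)) ((differentiableOn_const α).prodMk differentiableOn_id)
    fun _ hk => ⟨hα, hk⟩

/-- If one operator of the slice is invertible, the non-invertible ones are isolated. -/
theorem eventually_nhdsNE_isInvertible (hΩ : IsOpen Ω)
    (hol : DifferentiableOn ℂ (fun p : ℂ × ℂ => Q p.1 p.2) (Ω ×ˢ Set.univ))
    (fred : ∀ α ∈ Ω, ∀ k : ℂ, IsFredholmIndexZero (Q α k)) {α : ℂ} (hα : α ∈ Ω)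
    (hinv : ∃ k₀, (Q α k₀).IsInvertible) (k : ℂ) :
    ∀ᶠ ζ in 𝓝[≠] k, (Q α ζ).IsInvertible := by
  have hdich : ∀ k, (∀ᶠ ζ in 𝓝 k, ¬ (Q α ζ).IsInvertible) ∨
      ∀ᶠ ζ in 𝓝[≠] k, (Q α ζ).IsInvertible := by
    intro k
    obtain ⟨ε, hε, d, -, hd, hiff, -⟩ := exists_local_determinant hΩ hol fred hα k
    have hαb := mem_ball_self (x := α) hε
    have han := (differentiableOn_slice hd hαb).analyticAt (ball_mem_nhds k hε)
    rcases han.eventually_eq_zero_or_eventually_ne_zero with h | h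
    · left
      filter_upwards [h, ball_mem_nhds k hε] with ζ h0 hζ
      simp [hiff α hαb ζ hζ, h0]
    · right
      filter_upwards [h, nhdsWithin_le_nhds (ball_mem_nhds k hε)] with ζ h0 hζ
      exact (hiff α hαb ζ hζ).2 h0
  -- By the dichotomy `N` is clopen in the connected plane, and it misses `k₀`.
  set N : Set ℂ := {k | ∀ᶠ ζ in 𝓝 k, ¬ (Q α ζ).IsInvertible} with hN
  have hopen : IsOpen N := isOpen_setOfPred_eventually_nhds
  have hclosed : IsClosed N := by
    refine isClosed_of_closure_subset fun k hk => ?_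
    refine (hdich k).resolve_right fun h => ?_
    rw [eventually_nhdsWithin_iff, _root_.eventually_nhds_iff] at h
    obtain ⟨O, hO, hOo, hkO⟩ := h
    obtain ⟨k', hk'O, hk'N⟩ := mem_closure_iff.1 hk O hOo hkO
    have h1 : ∀ᶠ ζ in 𝓝[≠] k', ζ ∈ O ∧ ζ ≠ k ∧ ¬ (Q α ζ).IsInvertible := by
      have h2 : ∀ᶠ ζ in 𝓝[≠] k', ζ ≠ k := by
        by_cases hkk : k' = k
        · rw [hkk]; exact eventually_mem_nhdsWithin
        · exact nhdsWithin_le_nhds (isOpen_ne.mem_nhds hkk)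
      filter_upwards [nhdsWithin_le_nhds (hOo.mem_nhds hk'O), h2, nhdsWithin_le_nhds hk'N]
        with ζ h3 h4 h5 using ⟨h3, h4, h5⟩
    obtain ⟨ζ, h3, h4, h5⟩ := h1.exists
    exact h5 (hO ζ h3 h4)
  rcases isClopen_iff.1 ⟨hclosed, hopen⟩ with h | h
  · refine (hdich k).resolve_left fun hk => ?_
    have : k ∈ N := hk
    rw [h] at this
    exact this
  · obtain ⟨k₀, hk₀⟩ := hinv
    have : k₀ ∈ N := by rw [h]; trivial
    exact absurd hk₀ this.self_of_nhds

theorem mult_eq_logResidueTrace (hΩ : IsOpen Ω)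
    (hol : DifferentiableOn ℂ (fun p : ℂ × ℂ => Q p.1 p.2) (Ω ×ˢ Set.univ)) {α : ℂ} (hα : α ∈ Ω)
    (hinv : ∃ k₀, (Q α k₀).IsInvertible) {k : ℂ} {r : ℝ} (hr : IsIsolatingRadius (Q α) k r) :
    mult Q α k = ((logResidueTrace (Q α) k r : ℂ) : WithTop ℂ) := by
  obtain ⟨k₀, hk₀⟩ := hinv
  unfold mult
  rw [if_pos ⟨k₀, ker_eq_bot_of_isInvertible hk₀⟩,
    logResidueTrace_eq (differentiable_slice hol hΩ hα)
      (Classical.epsilon_spec (p := IsIsolatingRadius (Q α) k) ⟨r, hr⟩) hr]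

theorem mult_eq_top_iff (fred : ∀ α ∈ Ω, ∀ k : ℂ, IsFredholmIndexZero (Q α k)) {α : ℂ}
    (hα : α ∈ Ω) (k : ℂ) : mult Q α k = ⊤ ↔ ∀ k₀, ¬ (Q α k₀).IsInvertible := by
  unfold mult
  simp only [(fred α hα _).isInvertible_iff]
  split_ifs with h
  · simpa using h
  · simpa using h

/-- In `F⁻¹ F'` the factors acting on `Y` cancel, so translation by `γ` only conjugates the integral
by `e`. -/
theorem logResidueTrace_comp_add_const {F : ℂ → X →L[ℂ] Y} (hF : Differentiable ℂ F) {γ : ℂ}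
    (e : X ≃L[ℂ] X) (e' : Y ≃L[ℂ] Y)
    (hcov : ∀ k, F (k + γ) = (e'.symm : Y →L[ℂ] Y) ∘L F k ∘L (e : X →L[ℂ] X)) {k : ℂ} {r : ℝ}
    (hr : IsIsolatingRadius F k r) :
    logResidueTrace F (k + γ) r = logResidueTrace F k r := by
  have hder : ∀ ζ, deriv F (ζ + γ) = (e'.symm : Y →L[ℂ] Y) ∘L deriv F ζ ∘L (e : X →L[ℂ] X) := by
    intro ζ
    rw [← deriv_comp_add_const F γ ζ, show (fun x => F (x + γ)) = _ from funext hcov]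
    have h1 := (hasDerivAt_const ζ (e'.symm : Y →L[ℂ] Y)).clm_comp
      ((hF ζ).hasDerivAt.clm_comp (hasDerivAt_const ζ (e : X →L[ℂ] X)))
    rw [h1.deriv]
    simp
  have hshift : (∮ ζ in C(k + γ, r), (F ζ).inverse ∘L deriv F ζ) =
      ∮ ζ in C(k, r), (F (ζ + γ)).inverse ∘L deriv F (ζ + γ) := by
    simp only [circleIntegral, deriv_circleMap]
    have : ∀ θ, circleMap (k + γ) r θ = circleMap k r θ + γ := fun θ => by
      simp only [circleMap]; ring
    simp only [this]
  let L : (X →L[ℂ] X) →L[ℂ] (X →L[ℂ] X) :=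
    (compL ℂ X X X (e.symm : X →L[ℂ] X)) ∘L ((compL ℂ X X X).flip (e : X →L[ℂ] X))
  have hcont : ContinuousOn (fun ζ => (F ζ).inverse ∘L deriv F ζ) (sphere k r) := by
    intro ζ hζ
    have h1 := differentiableAt_inverse (hF ζ)
      (hr.2 ζ (sphere_subset_closedBall hζ) (ne_of_mem_sphere hζ hr.1.ne'))
    have h2 := ((hF.analyticAt ζ).deriv).differentiableAt
    exact (h1.clm_comp h2).continuousAt.continuousWithinAt
  have hL : (∮ ζ in C(k, r), (F (ζ + γ)).inverse ∘L deriv F (ζ + γ)) =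
      L (∮ ζ in C(k, r), (F ζ).inverse ∘L deriv F ζ) := by
    rw [← circleIntegral_clm_apply L (hcont.circleIntegrable hr.1.le)]
    refine circleIntegral.integral_congr hr.1.le fun ζ hζ => ?_
    obtain ⟨t, ht⟩ := hr.2 ζ (sphere_subset_closedBall hζ) (ne_of_mem_sphere hζ hr.1.ne')
    have h1 : (F (ζ + γ)).inverse = (e.symm : X →L[ℂ] X) ∘L (F ζ).inverse ∘L
        (e' : Y →L[ℂ] Y) := by
      rw [hcov, ← ht]
      apply ContinuousLinearMap.inverse_eq
      · ext y; simp
      · ext x; simp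
    simp only [h1, hder]
    ext x
    simp [L]
  unfold logResidueTrace
  rw [hshift, hL]
  congr 1
  exact finiteRankTrace_conj e _

theorem mult_add_of_covariant (hΩ : IsOpen Ω)
    (hol : DifferentiableOn ℂ (fun p : ℂ × ℂ => Q p.1 p.2) (Ω ×ˢ Set.univ))
    (fred : ∀ α ∈ Ω, ∀ k : ℂ, IsFredholmIndexZero (Q α k)) {α : ℂ} (hα : α ∈ Ω) {γ : ℂ}
    (e : X ≃L[ℂ] X) (e' : Y ≃L[ℂ] Y)
    (hcov : ∀ k, Q α (k + γ) = (e'.symm : Y →L[ℂ] Y) ∘L Q α k ∘L (e : X →L[ℂ] X)) (k : ℂ) :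
    mult Q α (k + γ) = mult Q α k := by
  by_cases hinv : ∃ k₀, (Q α k₀).IsInvertible
  · obtain ⟨r, -, hr⟩ := exists_isIsolatingRadius
      (eventually_nhdsNE_isInvertible hΩ hol fred hα hinv k) one_pos
    have hr' : IsIsolatingRadius (Q α) (k + γ) r := by
      refine ⟨hr.1, fun ζ hζ hne => ?_⟩
      have h1 := hr.2 (ζ - γ) (by
        rw [mem_closedBall, dist_eq_norm] at hζ ⊢
        rwa [show ζ - γ - k = ζ - (k + γ) by ring]) (fun h => hne (by rw [← h]; ring))
      have h2 := hcov (ζ - γ)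
      rw [sub_add_cancel] at h2
      rw [h2]
      obtain ⟨t, ht⟩ := h1
      exact ⟨(e.trans t).trans e'.symm, by rw [← ht]; ext x; simp⟩
    rw [mult_eq_logResidueTrace hΩ hol hα hinv hr, mult_eq_logResidueTrace hΩ hol hα hinv hr',
      logResidueTrace_comp_add_const (differentiable_slice hol hΩ hα) e e' hcov hr]
  · push Not at hinv
    rw [(mult_eq_top_iff fred hα _).2 hinv, (mult_eq_top_iff fred hα _).2 hinv]

/-- Near a parameter with isolated multiplicities, the multiplicity at a point splits into the
multiplicities at the nearby points. -/
theorem eventually_mult_eq_sum (hΩ : IsOpen Ω)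
    (hol : DifferentiableOn ℂ (fun p : ℂ × ℂ => Q p.1 p.2) (Ω ×ˢ Set.univ))
    (fred : ∀ α ∈ Ω, ∀ k : ℂ, IsFredholmIndexZero (Q α k)) {α₁ : ℂ} (hα₁ : α₁ ∈ Ω)
    (hinv₁ : ∃ k₀, (Q α₁ k₀).IsInvertible) (k₁ : ℂ) :
    ∃ ε > 0, ∀ r < ε, IsIsolatingRadius (Q α₁) k₁ r → ∀ᶠ α in 𝓝 α₁,
      α ∈ Ω ∧ (∃ k₀, (Q α k₀).IsInvertible) ∧ ∃ (Z : Finset ℂ) (n : ℂ → ℕ),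
        (∀ z, z ∈ Z ↔ z ∈ closedBall k₁ r ∧ ¬ (Q α z).IsInvertible) ∧ (∀ u ∈ Z, n u ≠ 0) ∧
        (∀ u ∈ Z, mult Q α u = ((n u : ℂ) : WithTop ℂ)) ∧
        mult Q α₁ k₁ = (((∑ u ∈ Z, n u : ℕ) : ℂ) : WithTop ℂ) := by
  obtain ⟨ε, hε, d, hsubΩ, hd, hiff, hres⟩ := exists_local_determinant hΩ hol fred hα₁ k₁
  refine ⟨ε, hε, fun r hrε hr => ?_⟩
  have hr0 := hr.1
  have hsub : closedBall k₁ r ⊆ ball k₁ ε := closedBall_subset_ball hrε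
  have hα₁b := mem_ball_self (x := α₁) hε
  have hs : ∀ z ∈ sphere k₁ r, d α₁ z ≠ 0 := fun z hz =>
    (hiff α₁ hα₁b z (hsub (sphere_subset_closedBall hz))).1
      (hr.2 z (sphere_subset_closedBall hz) (ne_of_mem_sphere hz hr0.ne'))
  have h2πi : (2 * Real.pi * Complex.I : ℂ) ≠ 0 := Complex.two_pi_I_ne_zero
  filter_upwards [ball_mem_nhds α₁ hε, eventually_circleIntegral_logDeriv_eq isOpen_ball
    (ball_mem_nhds α₁ hε) hd.continuousOn (fun α hα => differentiableOn_slice hd hα) hr0 hsub hs]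
    with α hα hαint
  obtain ⟨hαs, hαint⟩ := hαint
  have hαΩ := hsubΩ hα
  have hmem : k₁ + r ∈ sphere k₁ r := by simp [abs_of_pos hr0]
  have hinv : ∃ k₀, (Q α k₀).IsInvertible :=
    ⟨_, (hiff α hα _ (hsub (sphere_subset_closedBall hmem))).2 (hαs _ hmem)⟩
  classical
  obtain ⟨Z, n, hZ, hn, hcirc⟩ := exists_circleIntegral_logDeriv_eq_sum isOpen_ball
    (differentiableOn_slice hd hα) hr0 hsub hαs
  have hZ' : ∀ z, z ∈ Z ↔ z ∈ closedBall k₁ r ∧ ¬ (Q α z).IsInvertible := fun z => by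
    rw [hZ]
    refine and_congr_right fun hz => ?_
    rw [hiff α hα z (hsub hz), not_not]
  have hZball : ∀ z ∈ Z, z ∈ ball k₁ r := fun z hz => by
    have h1 := (hZ z).1 hz
    rw [← ball_union_sphere] at h1
    exact h1.1.resolve_right fun h => hαs z h h1.2
  refine ⟨hαΩ, hinv, Z, n, hZ', hn, ?_, ?_⟩
  · intro u hu
    -- A circle around `u` that isolates it within the disc picks out the single weight `n u`, which
    -- is thereby the multiplicity at `u`.
    obtain ⟨δ, hδ, hδsub⟩ := Metric.isOpen_iff.1 isOpen_ball u (hZball u hu)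
    obtain ⟨ρ, hρδ, hρ⟩ := exists_isIsolatingRadius
      (eventually_nhdsNE_isInvertible hΩ hol fred hαΩ hinv u) hδ
    have hρsub : closedBall u ρ ⊆ closedBall k₁ r :=
      ((closedBall_subset_ball hρδ).trans hδsub).trans ball_subset_closedBall
    have hfilter : Z.filter (· ∈ ball u ρ) = {u} := by
      ext z
      rw [Finset.mem_filter, Finset.mem_singleton]
      constructor
      · rintro ⟨hzZ, hz⟩
        by_contra hne
        exact ((hZ' z).1 hzZ).2 (hρ.2 z (ball_subset_closedBall hz) hne)
      · rintro rfl
        exact ⟨hu, mem_ball_self hρ.1⟩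
    have h1 := hcirc u ρ hρ.1 hρsub fun z hz =>
      (hiff α hα z (hsub (hρsub (sphere_subset_closedBall hz)))).1
        (hρ.2 z (sphere_subset_closedBall hz) (ne_of_mem_sphere hz hρ.1.ne'))
    rw [hfilter, Finset.sum_singleton] at h1
    rw [mult_eq_logResidueTrace hΩ hol hαΩ hinv hρ, hres α hα u ρ (hρsub.trans hsub) hρ, h1,
      inv_mul_cancel_left₀ h2πi]
  · have h1 := hcirc k₁ r hr0 le_rfl hαs
    rw [Finset.filter_true_of_mem hZball] at h1
    rw [mult_eq_logResidueTrace hΩ hol hα₁ hinv₁ hr, hres α₁ hα₁b k₁ r hsub hr, ← hαint, h1,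
      inv_mul_cancel_left₀ h2πi]

/-- The multiplicity is a natural number, which vanishes exactly where the operator is
invertible. -/
theorem exists_mult_eq_natCast (hΩ : IsOpen Ω)
    (hol : DifferentiableOn ℂ (fun p : ℂ × ℂ => Q p.1 p.2) (Ω ×ˢ Set.univ))
    (fred : ∀ α ∈ Ω, ∀ k : ℂ, IsFredholmIndexZero (Q α k)) {α : ℂ} (hα : α ∈ Ω)
    (hinv : ∃ k₀, (Q α k₀).IsInvertible) (k : ℂ) :
    ∃ n : ℕ, mult Q α k = ((n : ℂ) : WithTop ℂ) ∧ (n = 0 ↔ (Q α k).IsInvertible) := by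
  obtain ⟨ε, hε, h⟩ := eventually_mult_eq_sum hΩ hol fred hα hinv k
  obtain ⟨r, hrε, hr⟩ := exists_isIsolatingRadius
    (eventually_nhdsNE_isInvertible hΩ hol fred hα hinv k) hε
  -- The splitting is used at the base parameter itself, where only `k` can occur in `Z`.
  obtain ⟨-, -, Z, n, hZ, hn, -, hsum⟩ := (h r hrε hr).self_of_nhds
  refine ⟨_, hsum, ?_⟩
  rw [Finset.sum_eq_zero_iff]
  constructor
  · intro h0
    by_contra hk
    have hkZ := (hZ k).2 ⟨mem_closedBall_self hr.1.le, hk⟩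
    exact hn k hkZ (h0 k hkZ)
  · intro hk u hu
    exfalso
    obtain ⟨hub, hui⟩ := (hZ u).1 hu
    by_cases huk : u = k
    · exact hui (huk ▸ hk)
    · exact hui (hr.2 u hub huk)

end Family

end FlatBands

namespace FlatBands

open Metric Filter Topology ContinuousLinearMap

/-! ### Connectedness in the plane and compactness modulo a lattice. -/

section Plane

theorem isOpen_eventually_nhdsNE (P : ℂ → Prop) : IsOpen {a : ℂ | ∀ᶠ x in 𝓝[≠] a, P x} := by
  rw [isOpen_iff_mem_nhds]
  intro a ha
  have ha' : ∀ᶠ x in 𝓝[≠] a, P x := ha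
  rw [eventually_nhdsWithin_iff, _root_.eventually_nhds_iff] at ha'
  obtain ⟨O, hO, hOo, haO⟩ := ha'
  filter_upwards [hOo.mem_nhds haO] with y hy
  by_cases hya : y = a
  · rw [hya]; exact ha
  · refine nhdsWithin_le_nhds ?_
    filter_upwards [hOo.mem_nhds hy, isOpen_ne.mem_nhds hya] with x hx hxa using hO x hx hxa

/-- The punctured disc is the image of a half-plane, which is convex, under `z ↦ a + exp z`. -/
theorem isPreconnected_ball_diff_center (a : ℂ) {ε : ℝ} (hε : 0 < ε) :
    IsPreconnected (ball a ε \ {a}) := by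
  have himage : (fun z => a + Complex.exp z) '' {z : ℂ | z.re < Real.log ε} = ball a ε \ {a} := by
    ext w
    constructor
    · rintro ⟨z, hz, rfl⟩
      refine ⟨?_, by simp⟩
      simp only [mem_ball, dist_eq_norm, add_sub_cancel_left, Complex.norm_exp]
      exact (Real.lt_log_iff_exp_lt hε).1 hz
    · rintro ⟨hw, hwa⟩
      have hne : w - a ≠ 0 := sub_ne_zero.2 hwa
      refine ⟨Complex.log (w - a), ?_, ?_⟩
      · simp only [Set.mem_ofPred_eq, Complex.log_re]
        exact Real.log_lt_log (norm_pos_iff.2 hne) (by simpa [dist_eq_norm] using hw)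
      · simp only [Complex.exp_log hne]; ring
  rw [← himage]
  have hconv : Convex ℝ {z : ℂ | z.re < Real.log ε} := convex_halfSpace_re_lt _
  exact hconv.isPreconnected.image _ (by fun_prop)

/-- A relatively clopen property on a connected open set minus a set without accumulation points
holds everywhere as soon as it holds somewhere. -/
theorem forall_of_forall_eventually {Ω A : Set ℂ} (hΩo : IsOpen Ω) (hΩ : IsPreconnected Ω)
    (hA : ∀ a ∈ Ω, ∀ᶠ x in 𝓝[≠] a, x ∉ A) {P : ℂ → Prop}
    (hP : ∀ a ∈ Ω \ A, P a → ∀ᶠ x in 𝓝 a, P x) (hP' : ∀ a ∈ Ω \ A, ¬ P a → ∀ᶠ x in 𝓝 a, ¬ P x)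
    {a₀ : ℂ} (ha₀ : a₀ ∈ Ω \ A) (hPa₀ : P a₀) {a : ℂ} (ha : a ∈ Ω \ A) : P a := by
  -- Punctured neighbourhoods let `u` and `v` cover the points of `A` too, so the connectedness of
  -- `Ω` itself suffices.
  set u : Set ℂ := {a | ∀ᶠ x in 𝓝[≠] a, P x} with hu
  set v : Set ℂ := {a | ∀ᶠ x in 𝓝[≠] a, ¬ P x} with hv
  have hdisj : Disjoint u v := by
    rw [Set.disjoint_left]
    intro b (hbu : ∀ᶠ x in 𝓝[≠] b, P x) (hbv : ∀ᶠ x in 𝓝[≠] b, ¬ P x)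
    obtain ⟨x, hx, hx'⟩ := (hbu.and hbv).exists
    exact hx' hx
  have hcover : Ω ⊆ u ∪ v := by
    intro b hb
    have h1 : ∀ᶠ x in 𝓝[≠] b, x ∈ Ω \ A := by
      filter_upwards [nhdsWithin_le_nhds (hΩo.mem_nhds hb), hA b hb] with x hx hxA
        using ⟨hx, hxA⟩
    rw [eventually_nhdsWithin_iff, Metric.eventually_nhds_iff_ball] at h1
    obtain ⟨ε, hε, hball⟩ := h1
    have hmem : ∀ x ∈ ball b ε \ {b}, x ∈ Ω \ A := fun x hx => hball x hx.1 hx.2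
    have hnhds : ball b ε \ {b} ∈ 𝓝[≠] b :=
      sdiff_mem_nhdsWithin_compl (ball_mem_nhds b hε) {b}
    have hsub : ball b ε \ {b} ⊆ {x | ∀ᶠ y in 𝓝 x, P y} ∪ {x | ∀ᶠ y in 𝓝 x, ¬ P y} := by
      intro x hx
      by_cases hPx : P x
      · exact Or.inl (hP x (hmem x hx) hPx)
      · exact Or.inr (hP' x (hmem x hx) hPx)
    have hdisj' : Disjoint {x | ∀ᶠ y in 𝓝 x, P y} {x | ∀ᶠ y in 𝓝 x, ¬ P y} := by
      rw [Set.disjoint_left]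
      intro x hx hx'
      exact hx'.self_of_nhds hx.self_of_nhds
    by_cases hne : ∃ x ∈ ball b ε \ {b}, P x
    · obtain ⟨x, hx, hPx⟩ := hne
      left
      filter_upwards [hnhds] with y hy
      exact ((isPreconnected_ball_diff_center b hε).subset_left_of_subset_union
        isOpen_setOfPred_eventually_nhds isOpen_setOfPred_eventually_nhds hdisj' hsub
        ⟨x, hx, hP x (hmem x hx) hPx⟩ hy).self_of_nhds
    · right
      push Not at hne
      filter_upwards [hnhds] with y hy using hne y hy
  have hΩu : Ω ⊆ u := hΩ.subset_left_of_subset_union (isOpen_eventually_nhdsNE _)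
    (isOpen_eventually_nhdsNE _) hdisj hcover ⟨a₀, ha₀.1, nhdsWithin_le_nhds (hP a₀ ha₀ hPa₀)⟩
  by_contra hna
  have h1 : ∀ᶠ x in 𝓝[≠] a, ¬ P x := nhdsWithin_le_nhds (hP' a ha hna)
  have h2 : ∀ᶠ x in 𝓝[≠] a, P x := hΩu ha.1
  obtain ⟨x, hx, hx'⟩ := (h2.and h1).exists
  exact hx' hx

/-- The closure of a fundamental domain works; it turns local statements about periodic data into
statements uniform in `k`. -/
theorem exists_isCompact_forall_exists_add (Γ : Submodule ℤ ℂ) [DiscreteTopology Γ]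
    [IsZLattice ℝ Γ] : ∃ K : Set ℂ, IsCompact K ∧ ∀ k : ℂ, ∃ k' ∈ K, ∃ γ : Γ, k = k' + γ := by
  have : Module.Free ℤ Γ := ZLattice.module_free ℝ Γ
  have : Module.Finite ℤ Γ := ZLattice.module_finite ℝ Γ
  let b := (Module.Free.chooseBasis ℤ Γ).ofZLatticeBasis ℝ Γ
  refine ⟨closure (ZSpan.fundamentalDomain b),
    (ZSpan.fundamentalDomain_isBounded b).isCompact_closure, fun k => ?_⟩
  refine ⟨ZSpan.fract b k, subset_closure (ZSpan.fract_mem_fundamentalDomain b k), ?_⟩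
  have hmem : ((ZSpan.floor b k : Submodule.span ℤ (Set.range b)) : ℂ) ∈ Γ := by
    have h1 : Submodule.span ℤ (Set.range b) = Γ :=
      (Module.Free.chooseBasis ℤ Γ).ofZLatticeBasis_span ℝ Γ
    exact h1.le (ZSpan.floor b k).2
  exact ⟨⟨_, hmem⟩, by rw [ZSpan.fract_apply]; simp⟩

end Plane

/-! ### The exceptional set, and openness and closedness of the equality of multiplicities. -/

section Main

variable {X Y : Type*} [NormedAddCommGroup X] [NormedSpace ℂ X] [CompleteSpace X]
  [NormedAddCommGroup Y] [NormedSpace ℂ Y] [CompleteSpace Y]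
  {Ω : Set ℂ} {Q : ℂ → ℂ → X →L[ℂ] Y}

/-- The parameters at which no operator of the slice is invertible do not accumulate, unless they
fill the domain. -/
theorem eventually_nhdsNE_exists_isInvertible (hΩ : IsOpen Ω) (hΩc : IsPreconnected Ω)
    (hol : DifferentiableOn ℂ (fun p : ℂ × ℂ => Q p.1 p.2) (Ω ×ˢ Set.univ))
    (fred : ∀ α ∈ Ω, ∀ k : ℂ, IsFredholmIndexZero (Q α k)) {α₀ : ℂ} (hα₀ : α₀ ∈ Ω)
    (hinv₀ : ∃ k, (Q α₀ k).IsInvertible) {a : ℂ} (ha : a ∈ Ω) :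
    ∀ᶠ α in 𝓝[≠] a, ∃ k, (Q α k).IsInvertible := by
  set P : ℂ → Prop := fun α => ∃ k, (Q α k).IsInvertible with hP
  have hdich : ∀ b ∈ Ω, (∀ᶠ α in 𝓝[≠] b, P α) ∨ ∀ᶠ α in 𝓝 b, ¬ P α := by
    intro b hb
    refine or_iff_not_imp_left.2 fun hacc => ?_
    obtain ⟨ε, hε, d, hsubΩ, hd, hiff, -⟩ := exists_local_determinant hΩ hol fred hb 0
    -- For each fixed `k`, accumulation of singular slices at `b` makes `d(·, k)` vanish identically
    -- by the identity theorem. The base point `0` in the `k`-plane is arbitrary.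
    have hzero : ∀ k ∈ ball (0 : ℂ) ε, ∀ α ∈ ball b ε, d α k = 0 := by
      intro k hk
      have hdk : DifferentiableOn ℂ (fun α => d α k) (ball b ε) :=
        hd.comp (f := fun α : ℂ => (α, k))
          (differentiableOn_id.prodMk (differentiableOn_const k)) fun _ hα => ⟨hα, hk⟩
      have hfreq : ∃ᶠ α in 𝓝[≠] b, d α k = 0 := by
        have h1 : ∃ᶠ α in 𝓝[≠] b, ¬ P α := not_eventually.1 hacc
        refine (h1.and_eventually (nhdsWithin_le_nhds (ball_mem_nhds b hε))).mono ?_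
        rintro α ⟨hα, hαb⟩
        by_contra hne
        exact hα ⟨k, (hiff α hαb k hk).2 hne⟩
      exact (hdk.analyticOnNhd isOpen_ball).eqOn_zero_of_preconnected_of_frequently_eq_zero
        (convex_ball b ε).isPreconnected (mem_ball_self hε) hfreq
    filter_upwards [ball_mem_nhds b hε] with α hα hPα
    -- A single invertible operator anywhere in the slice would yield invertible ones arbitrarily
    -- close to `0`, where `d` vanishes.
    have h1 := eventually_nhdsNE_isInvertible hΩ hol fred (hsubΩ hα) hPα 0
    obtain ⟨k, hk, hkb⟩ := (h1.and (nhdsWithin_le_nhds (ball_mem_nhds 0 hε))).exists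
    exact (hiff α hα k hkb).1 hk (hzero k hkb α hα)
  have hdisj : Disjoint {b | ∀ᶠ α in 𝓝[≠] b, P α} {b | ∀ᶠ α in 𝓝 b, ¬ P α} := by
    rw [Set.disjoint_left]
    intro b (h1 : ∀ᶠ α in 𝓝[≠] b, P α) (h2 : ∀ᶠ α in 𝓝 b, ¬ P α)
    obtain ⟨x, hx, hx'⟩ := (h1.and (h2.filter_mono nhdsWithin_le_nhds)).exists
    exact hx' hx
  refine hΩc.subset_left_of_subset_union (isOpen_eventually_nhdsNE P)
    isOpen_setOfPred_eventually_nhds hdisj hdich ⟨α₀, hα₀, ?_⟩ ha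
  exact (hdich α₀ hα₀).resolve_right fun h => h.self_of_nhds hinv₀

/-- If the multiplicities at `α₁` are a lower bound for all multiplicities, they are attained near
`α₁`, locally in `k`. -/
theorem eventually_mult_eq_of_le (hΩ : IsOpen Ω)
    (hol : DifferentiableOn ℂ (fun p : ℂ × ℂ => Q p.1 p.2) (Ω ×ˢ Set.univ))
    (fred : ∀ α ∈ Ω, ∀ k : ℂ, IsFredholmIndexZero (Q α k)) {α₁ : ℂ} (hα₁ : α₁ ∈ Ω)
    (hinv₁ : ∃ k, (Q α₁ k).IsInvertible)
    (hle : ∀ α ∈ Ω, ∀ k, mult Q α₁ k ≤ mult Q α k) (k₁ : ℂ) :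
    ∀ᶠ z : ℂ × ℂ in 𝓝 (α₁, k₁), mult Q z.1 z.2 = mult Q α₁ z.2 := by
  obtain ⟨ε, hε, h⟩ := eventually_mult_eq_sum hΩ hol fred hα₁ hinv₁ k₁
  obtain ⟨r, hrε, hr⟩ := exists_isIsolatingRadius
    (eventually_nhdsNE_isInvertible hΩ hol fred hα₁ hinv₁ k₁) hε
  have hzero : ∀ α ∈ Ω, (∃ k, (Q α k).IsInvertible) → ∀ k, (Q α k).IsInvertible →
      mult Q α k = ((0 : ℂ) : WithTop ℂ) := by
    intro α hα hinv k hk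
    obtain ⟨n, hn, hn0⟩ := exists_mult_eq_natCast hΩ hol fred hα hinv k
    rw [hn, hn0.2 hk, Nat.cast_zero]
  have key : ∀ᶠ α in 𝓝 α₁, ∀ k ∈ closedBall k₁ r, mult Q α k = mult Q α₁ k := by
    filter_upwards [h r hrε hr] with α hα
    obtain ⟨hαΩ, hinv, Z, n, hZ, hn, hmult, hsum⟩ := hα
    have hk₁b : k₁ ∈ closedBall k₁ r := mem_closedBall_self hr.1.le
    have hlek := hle α hαΩ k₁
    -- Minimality says that the term at `k₁` is at least the whole sum; the weights in `Z` are
    -- positive, so no other point occurs.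
    have hZk : Z ⊆ {k₁} ∧ mult Q α k₁ = mult Q α₁ k₁ := by
      by_cases hk₁Z : k₁ ∈ Z
      · have h2 := hlek
        rw [hsum, hmult k₁ hk₁Z, WithTop.coe_le_coe, Nat.cast_le] at h2
        have h3 : ∑ u ∈ Z.erase k₁, n u = 0 := by
          rw [← Finset.add_sum_erase Z n hk₁Z] at h2
          omega
        rw [Finset.sum_eq_zero_iff] at h3
        refine ⟨fun u hu => ?_, ?_⟩
        · by_contra hne
          rw [Finset.mem_singleton] at hne
          exact hn u hu (h3 u (Finset.mem_erase.2 ⟨hne, hu⟩))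
        · rw [hsum, hmult k₁ hk₁Z, ← Finset.add_sum_erase Z n hk₁Z,
            Finset.sum_eq_zero h3, add_zero]
      · have hinvk : (Q α k₁).IsInvertible := by
          by_contra hcon
          exact hk₁Z ((hZ k₁).2 ⟨hk₁b, hcon⟩)
        have h2 := hlek
        have h0 := hzero α hαΩ hinv k₁ hinvk
        rw [hsum, h0, WithTop.coe_le_coe, ← Nat.cast_zero, Nat.cast_le, Nat.le_zero,
          Finset.sum_eq_zero_iff] at h2
        refine ⟨fun u hu => absurd (h2 u hu) (hn u hu), ?_⟩
        rw [h0, hsum, Finset.sum_eq_zero h2, Nat.cast_zero]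
    intro k hk
    by_cases hkk : k = k₁
    · rw [hkk]; exact hZk.2
    · rw [hzero α₁ hα₁ hinv₁ k (hr.2 k hk hkk)]
      refine hzero α hαΩ hinv k ?_
      by_contra hcon
      exact hkk (Finset.mem_singleton.1 (hZk.1 ((hZ k).2 ⟨hk, hcon⟩)))
  rw [nhds_prod_eq]
  filter_upwards [prod_mem_prod key (closedBall_mem_nhds k₁ hr.1)] with z hz
  exact hz.1 z.2 hz.2

/-- The set of parameters with prescribed multiplicities is relatively closed. -/
theorem eventually_ne_of_mult_ne (hΩ : IsOpen Ω)
    (hol : DifferentiableOn ℂ (fun p : ℂ × ℂ => Q p.1 p.2) (Ω ×ˢ Set.univ))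
    (fred : ∀ α ∈ Ω, ∀ k : ℂ, IsFredholmIndexZero (Q α k)) {α₀ : ℂ} (hα₀ : α₀ ∈ Ω)
    (hinv₀ : ∃ k, (Q α₀ k).IsInvertible) {α₁ : ℂ} (hα₁ : α₁ ∈ Ω)
    (hinv₁ : ∃ k, (Q α₁ k).IsInvertible) (hne : ¬ ∀ k, mult Q α₁ k = mult Q α₀ k) :
    ∀ᶠ α in 𝓝 α₁, ¬ ∀ k, mult Q α k = mult Q α₀ k := by
  push Not at hne
  obtain ⟨k₁, hk₁⟩ := hne
  obtain ⟨ε, hε, h⟩ := eventually_mult_eq_sum hΩ hol fred hα₁ hinv₁ k₁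
  obtain ⟨r₁, hr₁ε, hr₁⟩ := exists_isIsolatingRadius
    (eventually_nhdsNE_isInvertible hΩ hol fred hα₁ hinv₁ k₁) hε
  -- The radius must isolate `k₁` for `α₀` as well, since a nearby `α` with the multiplicities of
  -- `α₀` has the same singular points.
  obtain ⟨r, hrr₁, hr₀⟩ := exists_isIsolatingRadius
    (eventually_nhdsNE_isInvertible hΩ hol fred hα₀ hinv₀ k₁) hr₁.1
  have hr : IsIsolatingRadius (Q α₁) k₁ r := hr₁.mono hr₀.1 hrr₁.le
  filter_upwards [h r (hrr₁.trans hr₁ε) hr] with α hα heq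
  obtain ⟨hαΩ, hinv, Z, n, hZ, hn, hmult, hsum⟩ := hα
  have hiff : ∀ k, (Q α k).IsInvertible ↔ (Q α₀ k).IsInvertible := by
    intro k
    obtain ⟨m, hm, hm0⟩ := exists_mult_eq_natCast hΩ hol fred hαΩ hinv k
    obtain ⟨m', hm', hm0'⟩ := exists_mult_eq_natCast hΩ hol fred hα₀ hinv₀ k
    have h1 := heq k
    rw [hm, hm', WithTop.coe_inj, Nat.cast_inj] at h1
    rw [← hm0, ← hm0', h1]
  have hsub : Z ⊆ {k₁} := by
    intro u hu
    obtain ⟨hub, hui⟩ := (hZ u).1 hu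
    by_contra hne
    exact hui ((hiff u).2 (hr₀.2 u hub (by simpa using hne)))
  refine hk₁ ?_
  rw [← heq k₁, hsum]
  rcases Finset.subset_singleton_iff.1 hsub with rfl | rfl
  · obtain ⟨m, hm, hm0⟩ := exists_mult_eq_natCast hΩ hol fred hαΩ hinv k₁
    have : (Q α k₁).IsInvertible := by
      by_contra hcon
      simpa using (hZ k₁).2 ⟨mem_closedBall_self hr.1.le, hcon⟩
    rw [hm, hm0.2 this]
    simp
  · rw [hmult k₁ (by simp), Finset.sum_singleton]

end Main

end FlatBands

theorem theorem1 {X Y : Type*} [NormedAddCommGroup X] [NormedSpace ℂ X] [CompleteSpace X]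
    [NormedAddCommGroup Y] [NormedSpace ℂ Y] [CompleteSpace Y]
    (Ω : Set ℂ) (hΩo : IsOpen Ω) (hΩc : IsConnected Ω)
    (Q : ℂ → ℂ → X →L[ℂ] Y)
    (hol : DifferentiableOn ℂ (fun p : ℂ × ℂ => Q p.1 p.2) (Ω ×ˢ Set.univ))
    (fred : ∀ α ∈ Ω, ∀ k : ℂ, FlatBands.IsFredholmIndexZero (Q α k))
    (Γ : Submodule ℤ ℂ) [DiscreteTopology Γ] [IsZLattice ℝ Γ]
    (WX : Γ → X ≃L[ℂ] X) (WY : Γ → Y ≃L[ℂ] Y)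
    (cov : ∀ α ∈ Ω, ∀ (k : ℂ) (γ : Γ),
      Q α (k + γ) = ((WY γ).symm : Y →L[ℂ] Y) ∘L Q α k ∘L (WX γ : X →L[ℂ] X))
    (α₀ : ℂ) (hα₀ : α₀ ∈ Ω)
    (hyp : ∀ k : ℂ, FlatBands.mult Q α₀ k ≠ ⊤ ∧
      ∀ α ∈ Ω, FlatBands.mult Q α₀ k ≤ FlatBands.mult Q α k) :
    ∃ A : Set ℂ, A ⊆ Ω ∧ (∀ a ∈ Ω, ¬ AccPt a (Filter.principal A)) ∧
      ∀ α ∈ Ω, ∀ k : ℂ,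
        (α ∈ A → FlatBands.mult Q α k = ⊤) ∧
        (α ∉ A → FlatBands.mult Q α k = FlatBands.mult Q α₀ k) := by
  have hinv₀ : ∃ k, (Q α₀ k).IsInvertible := by
    by_contra hcon
    push Not at hcon
    exact (hyp 0).1 ((FlatBands.mult_eq_top_iff fred hα₀ 0).2 hcon)
  set A : Set ℂ := {α | α ∈ Ω ∧ ∀ k, ¬ (Q α k).IsInvertible} with hA
  have hinvA : ∀ α ∈ Ω \ A, ∃ k, (Q α k).IsInvertible := by
    intro α hα
    by_contra hcon
    push Not at hcon
    exact hα.2 ⟨hα.1, hcon⟩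
  have hdisc : ∀ a ∈ Ω, ∀ᶠ x in nhdsWithin a {a}ᶜ, x ∉ A := by
    intro a ha
    filter_upwards [FlatBands.eventually_nhdsNE_exists_isInvertible hΩo hΩc.isPreconnected hol fred
      hα₀ hinv₀ ha] with x hx hxA
    obtain ⟨k, hk⟩ := hx
    exact hxA.2 k hk
  refine ⟨A, fun α hα => hα.1, fun a ha hacc => ?_, fun α hα k => ⟨fun hαA => ?_, fun hαA => ?_⟩⟩
  · exact (accPt_iff_frequently_nhdsNE.1 hacc) (hdisc a ha)
  · exact (FlatBands.mult_eq_top_iff fred hα k).2 hαA.2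
  · obtain ⟨K, hK, hcover⟩ := FlatBands.exists_isCompact_forall_exists_add Γ
    have hper : ∀ α ∈ Ω, ∀ (k : ℂ) (γ : Γ),
        FlatBands.mult Q α (k + γ) = FlatBands.mult Q α k := fun α hα k γ =>
      FlatBands.mult_add_of_covariant hΩo hol fred hα (WX γ) (WY γ) (fun k => cov α hα k γ) k
    refine FlatBands.forall_of_forall_eventually hΩo hΩc.isPreconnected hdisc
      (P := fun α => ∀ k, FlatBands.mult Q α k = FlatBands.mult Q α₀ k) ?_ ?_
      (a₀ := α₀) ⟨hα₀, fun h => ?_⟩ (fun _ => rfl) ⟨hα, hαA⟩ k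
    · intro a ha haeq
      -- Minimality passes from `α₀` to every parameter with the same multiplicities.
      have hle : ∀ α ∈ Ω, ∀ k, FlatBands.mult Q a k ≤ FlatBands.mult Q α k := fun α hα k => by
        rw [haeq k]
        exact (hyp k).2 α hα
      have hev := hK.eventually_forall_of_forall_eventually
        (P := fun α k => FlatBands.mult Q α k = FlatBands.mult Q a k) fun k _ =>
          FlatBands.eventually_mult_eq_of_le hΩo hol fred ha.1 (hinvA a ha) hle k
      filter_upwards [hev, hΩo.mem_nhds ha.1] with x hx hxΩ k
      -- Equality on the compact set `K` spreads to all `k` by periodicity.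
      obtain ⟨k', hk', γ, rfl⟩ := hcover k
      rw [hper x hxΩ, hper α₀ hα₀, hx k' hk', haeq]
    · intro a ha hane
      exact FlatBands.eventually_ne_of_mult_ne hΩo hol fred hα₀ hinv₀ ha.1 (hinvA a ha) hane
    · obtain ⟨k₀, hk₀⟩ := hinv₀
      exact h.2 k₀ hk₀
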